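/- Let $\mathcal X$ be a measurable input space and let data points $(X,A,Y)$ take values in $\mathcal X\times\{0,1\}\times\{0,1\}$. For a distribution $\mathbb P$ of $(X,A,Y)$ and a classifier $h:\mathcal X\to\{0,1\}$ put $\mathcal R(h)=\mathbb P(h(X)\ne Y)$, $\mathcal D(h)=|\mathbb P(h(X)=1\mid A=0)-\mathbb P(h(X)=1\mid A=1)|$ and, for $\lambda\ge 0$, $L_\lambda(h)=\mathcal R(h)+\lambda\mathcal D(h)$. For a dataset $S=((x_i,a_i,y_i))_{i=1}^n$ put $$\widehat{\mathcal R}_S(h)=\frac1n\sum_{i=1}^n\mathbf 1\{h(x_i)\ne y_i\},\qquad \widehat{\mathcal D}_S(h)=\left|\frac{\sum_i\mathbf 1\{h(x_i)=1,a_i=0\}}{\sum_i\mathbf 1\{a_i=0\}}-\frac{\sum_i\mathbf 1\{h(x_i)=1,a_i=1\}}{\sum_i\mathbf 1\{a_i=1\}}\right|,$$ with $0/0=0$. There are universal constants $C,K>0$ such that the following holds. Let $\mathcal H$ be a set of classifiers $\mathcal X\to\{0,1\}$ with VC dimension $d<\infty$, let $\lambda\ge0$, and let $\mathcal L$ be any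 learner that maps every dataset $S$ of size $n\ge1$ to a minimizer of $\widehat{\mathcal R}_S(h)+\lambda\widehat{\mathcal D}_S(h)$ over $h\in\mathcal H$. Let $\mathbb P$ be a distribution of $(X,A,Y)$ with $0<P_0:=\mathbb P(A=0)\le\frac12$, and let $0\le\alpha<\frac12$. Assume that $\mathcal H$ satisfies the usual measurability conditions: every $h\in\mathcal H$ is measurable and, for all $m$ and $b\in\{0,1\}^m$, the set of $(x_1,\dots,x_m)\in\mathcal X^m$ for which some $h\in\mathcal H$ has $h(x_i)=b_i$ for all $i$ is measurable up to a null set of the $m$-fold product of the law of $X$. Set $$\Delta^{par}=\frac{2\alpha}{P_0/3+\alpha}.$$ Then $\Delta^{par}\le K\alpha/P_0$. Moreover let $\delta\in(0,1)$ and $$n\ge\max\left\{\frac{8\log(16/\delta)}{(1-\alpha)P_0},\ \frac{12\log(12/\delta)}{\alpha},\ \frac d2\right\}$$ (for $\alpha=0$ the second term is omitted). Let a clean dataset $S^c$ of $n$ points be drawn i.i.d. from $\mathbb P$, let every index in $\{1,\dots,n\}$ be marked independently with probability $\alpha$, independently of $S^c$, and let $S^p$ be any random dataset of size $n$ (chosen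 by a malicious, possibly randomized adversary of power $\alpha$, who may use full knowledge of $S^c$, the marks, $\mathbb P$ and $\mathcal L$) that coincides with $S^c$ at all unmarked indices. Then, with probability greater than $1-\delta$ over the clean data, the marks and the adversary, $$L_\lambda(\mathcal L(S^p))\le\inf_{h\in\mathcal H}L_\lambda(h)+3\alpha+2\lambda\Delta^{par}+C\sqrt{\log(2n/\delta)}\left(\sqrt{\frac dn}+\lambda\sqrt{\frac d{P_0n}}\right).$$ -/

import Mathlib

open MeasureTheory ProbabilityTheory

namespace FairLearning

noncomputable section

/-- A data point `(x, a, y)`: input, binary protected attribute, binary label. -/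
abbrev DataPoint (X : Type*) := X × Fin 2 × Fin 2

/-- A dataset of size `n`. -/
abbrev Dataset (X : Type*) (n : ℕ) := Fin n → DataPoint X

/-- `H` shatters the finite set `s` if every subset of `s` is cut out on `s` by some `h ∈ H`. -/
def Shatters {X : Type*} (H : Set (X → Fin 2)) (s : Finset X) : Prop :=
  ∀ t ⊆ s, ∃ h ∈ H, ∀ x ∈ s, (h x = 1 ↔ x ∈ t)

/-- The VC dimension: the supremum of the sizes of the finite shattered sets. -/
def vcDim {X : Type*} (H : Set (X → Fin 2)) : ℕ∞ :=
  ⨆ (s : Finset X) (_ : Shatters H s), (s.card : ℕ∞)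

/-- The usual measurability requirement on a hypothesis space, relative to the law `ν` of the
inputs: every hypothesis is measurable, and for every pattern `b` of labels the set of `m`-tuples
of inputs on which some hypothesis realises `b` is measurable up to a null set. (It holds for
countable classes, for pointwise limits of a countable subclass, for Suslin classes.) -/
structure MeasurableClass {X : Type*} [MeasurableSpace X] (H : Set (X → Fin 2))
    (ν : Measure X) : Prop where
  measurable : ∀ h ∈ H, Measurable h
  pattern : ∀ (m : ℕ) (b : Fin m → Fin 2),
    NullMeasurableSet {x : Fin m → X | ∃ h ∈ H, ∀ i, h (x i) = b i} (Measure.pi fun _ => ν)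

section Population

variable {X : Type*} [MeasurableSpace X]

/-- `P (A = a)`. -/
def groupProb (P : Measure (DataPoint X)) (a : Fin 2) : ℝ :=
  P.real {z | z.2.1 = a}

/-- The risk `P (h(X) ≠ Y)`. -/
def risk (P : Measure (DataPoint X)) (h : X → Fin 2) : ℝ :=
  P.real {z | h z.1 ≠ z.2.2}

/-- The conditional probability `P (h(X) = 1 | A = a)`. -/
def positiveRate (P : Measure (DataPoint X)) (h : X → Fin 2) (a : Fin 2) : ℝ :=
  (P[|{z | z.2.1 = a}]).real {z | h z.1 = 1}

/-- The mean difference score for demographic parity. -/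
def parityDeviation (P : Measure (DataPoint X)) (h : X → Fin 2) : ℝ :=
  |positiveRate P h 0 - positiveRate P h 1|

/-- The weighted objective `L_lam = risk + lam * deviation`. -/
def weightedObjective (P : Measure (DataPoint X)) (lam : ℝ) (h : X → Fin 2) : ℝ :=
  risk P h + lam * parityDeviation P h

end Population

section Empirical

variable {X : Type*} {n : ℕ}

/-- The empirical risk. -/
def empRisk (S : Dataset X n) (h : X → Fin 2) : ℝ :=
  ((Finset.univ.filter fun i => h (S i).1 ≠ (S i).2.2).card : ℝ) / n

/-- The fraction of positive predictions in group `a` of the dataset, with `0 / 0 = 0`. -/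
def empPositiveRate (S : Dataset X n) (h : X → Fin 2) (a : Fin 2) : ℝ :=
  ((Finset.univ.filter fun i => h (S i).1 = 1 ∧ (S i).2.1 = a).card : ℝ) /
    ((Finset.univ.filter fun i => (S i).2.1 = a).card : ℝ)

/-- The empirical estimate of the demographic parity deviation. -/
def empParityDeviation (S : Dataset X n) (h : X → Fin 2) : ℝ :=
  |empPositiveRate S h 0 - empPositiveRate S h 1|

/-- The empirical weighted objective. -/
def empObjective (S : Dataset X n) (lam : ℝ) (h : X → Fin 2) : ℝ :=
  empRisk S h + lam * empParityDeviation S h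

end Empirical

/-- The learner maps every nonempty dataset to a minimiser over `H` of the empirical weighted
objective. -/
def MinimizesEmpObjective {X : Type*} (H : Set (X → Fin 2)) (lam : ℝ)
    (learner : (n : ℕ) → Dataset X n → (X → Fin 2)) : Prop :=
  ∀ n : ℕ, 1 ≤ n → ∀ S : Dataset X n,
    learner n S ∈ H ∧ ∀ h ∈ H, empObjective S lam (learner n S) ≤ empObjective S lam h

/-- The data generation against a malicious adversary of power `α`, on a probability space that
carries the clean data, the marks and the randomness of the adversary: the clean points are i.i.d.
from `P`, every index is marked independently with probability `α`, the marks are independent of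
the clean data, and the corrupted dataset agrees with the clean one at the unmarked indices.
Nothing else is required of the corrupted dataset. -/
structure MaliciousSampling {X Ω : Type*} [MeasurableSpace X] [MeasurableSpace Ω] {n : ℕ}
    (P : Measure (DataPoint X)) (α : ℝ) (μ : Measure Ω)
    (clean : Ω → Dataset X n) (marked : Ω → Fin n → Bool) (corrupted : Ω → Dataset X n) :
    Prop where
  measurable_clean : Measurable clean
  clean_law : ∀ i, μ.map (fun ω => clean ω i) = P
  clean_indep : iIndepFun (fun (i : Fin n) (ω : Ω) => clean ω i) μ
  measurable_marked : Measurable marked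
  marked_prob : ∀ i, μ.real {ω | marked ω i = true} = α
  marked_indep : iIndepFun (fun (i : Fin n) (ω : Ω) => marked ω i) μ
  clean_marked_indep : IndepFun clean marked μ
  unmarked_eq : ∀ᵐ ω ∂μ, ∀ i, marked ω i = false → corrupted ω i = clean ω i

/-- The irreducible fairness term `2α / (P₀/3 + α)`. -/
def deltaPar (α P₀ : ℝ) : ℝ := 2 * α / (P₀ / 3 + α)

end

end FairLearning

namespace FairLearning

/-! The adversary acts only through the marked points, while the unmarked points of a group are
still an i.i.d. sample. So the proof compares the corrupted empirical objective with the population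
objective uniformly over `H`, loses a bounded amount to the marks, and uses that the learner
minimizes (`weightedObjective_le_iInf_add`).

Corruption: a Chernoff bound gives at most `3αn/2` marks. They move the empirical risk by at most
`3α/2`, which doubles to `3α`. In group `a`, with `c` unmarked and `m` marked points, the corrupted
positive rate is a mixture of the unmarked rate and a marked rate with weight `m / (c + m)` on the
latter. The two weights sum to at most `deltaPar`, the worst case being an even split of the marks
between groups of the least size `P₀n/4` (`div_add_div_le_deltaPar`).

Sampling: pairs (clean point, mark) are i.i.d., so the unmarked points of a group are those in a set
`W` of pairs, of mass `(1 - α) P(A = a)`. What is needed is a uniform bound of order `√(n ν(W) d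
log(2n/δ))` for counts restricted to `W`. Dividing by the count `n ν(W)` then gives the rate `√(d /
(P₀ n))`.

That bound is `measure_exists_deviation_le`. Jensen's inequality with a ghost sample dominates the
exponential of the deviation of each hypothesis by a sum over the finitely many labelings of the
double sample realised by `H`. Random swaps within pairs turn this into Rademacher sums, whose
exponents involve only the number of points in `W`, and Sauer–Shelah bounds the number of labelings.
Working with labelings instead of a supremum over `H` is what makes the pattern condition of
`MeasurableClass` sufficient. -/

/-- Some hypothesis in `H` labels the points `x` by `b`. -/
def Realizes {X ι : Type*} (H : Set (X → Fin 2)) (x : ι → X) (b : ι → Fin 2) : Prop :=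
  ∃ h ∈ H, ∀ i, h (x i) = b i

/-! ### Sauer–Shelah and sums over signs -/

lemma Shatters.card_le {X : Type*} {H : Set (X → Fin 2)} {d : ℕ} (hd : vcDim H ≤ d)
    {s : Finset X} (hs : Shatters H s) : s.card ≤ d := by
  have h : (s.card : ℕ∞) ≤ vcDim H := le_iSup₂_of_le s hs le_rfl
  exact_mod_cast h.trans hd

lemma sum_choose_le_pow (m d : ℕ) :
    ∑ k ∈ Finset.range (d + 1), m.choose k ≤ (m + 1) ^ d := by
  induction d with
  | zero => simp
  | succ d ih =>
    rw [Finset.sum_range_succ, pow_succ]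
    have h1 : m.choose (d + 1) ≤ m ^ (d + 1) := Nat.choose_le_pow _ _
    have h2 : m ^ (d + 1) ≤ (m + 1) ^ d * m := by
      rw [pow_succ]; gcongr; omega
    nlinarith

/-- The Sauer–Shelah bound on the number of labelings of a tuple of points. -/
lemma card_realizes_le {X : Type*} {H : Set (X → Fin 2)} {d m : ℕ} (hd : vcDim H ≤ d)
    (x : Fin m → X) [DecidablePred (Realizes H x)] :
    (Finset.univ.filter (Realizes H x)).card ≤ (m + 1) ^ d := by
  classical
  set Φ : (Fin m → Fin 2) → Finset (Fin m) := fun b => Finset.univ.filter fun i => b i = 1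
  have hΦ : Function.Injective Φ := by
    intro b c hbc
    funext i
    have : i ∈ Φ b ↔ i ∈ Φ c := by rw [hbc]
    simp only [Φ, Finset.mem_filter, Finset.mem_univ, true_and] at this
    omega
  set A : Finset (Finset (Fin m)) := (Finset.univ.filter (Realizes H x)).image Φ with hA
  have hcard : (Finset.univ.filter (Realizes H x)).card = A.card :=
    (Finset.card_image_of_injective _ hΦ).symm
  have hsh : ∀ s, A.Shatters s → s.card ≤ d := by
    intro s hs
    have key : ∀ t ⊆ s, ∃ h ∈ H, ∀ i ∈ s, (h (x i) = 1 ↔ i ∈ t) := by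
      intro t ht
      obtain ⟨u, hu, hut⟩ := hs ht
      rw [hA, Finset.mem_image] at hu
      obtain ⟨b, hb, rfl⟩ := hu
      obtain ⟨h, hH, hhb⟩ := (Finset.mem_filter.1 hb).2
      refine ⟨h, hH, fun i hi => ?_⟩
      rw [← hut]
      simp [Φ, hi, hhb]
    -- Repeated points cannot be separated, so a shattered set of indices maps to a shattered set of
    -- equally many points.
    have hinj : Set.InjOn x s := by
      intro i hi j hj hij
      obtain ⟨h, -, hh⟩ := key {i} (by simpa using hi)
      have h1 := hh i hi
      have h2 := hh j hj
      rw [hij, h2] at h1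
      exact (Finset.mem_singleton.1 (h1.2 (by simp))).symm
    rw [← Finset.card_image_of_injOn hinj]
    refine Shatters.card_le hd fun t ht => ?_
    obtain ⟨h, hH, hh⟩ := key (s.filter fun i => x i ∈ t) (Finset.filter_subset _ _)
    refine ⟨h, hH, fun z hz => ?_⟩
    obtain ⟨i, hi, rfl⟩ := Finset.mem_image.1 hz
    rw [hh i hi]
    simp [hi]
  rw [hcard]
  calc A.card ≤ A.shatterer.card := A.card_le_card_shatterer
    _ ≤ ∑ k ∈ Finset.Iic A.vcDim, (Fintype.card (Fin m)).choose k :=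
        Finset.card_shatterer_le_sum_vcDim
    _ ≤ ∑ k ∈ Finset.range (d + 1), m.choose k := by
        rw [Fintype.card_fin]
        refine Finset.sum_le_sum_of_subset fun k hk => ?_
        have : A.vcDim ≤ d := Finset.sup_le fun s hs => hsh s (Finset.mem_shatterer.1 hs)
        simp only [Finset.mem_Iic] at hk
        simp only [Finset.mem_range]
        omega
    _ ≤ (m + 1) ^ d := sum_choose_le_pow m d

/-- The sum over independent signs factors into `2 cosh (v i)`, and `cosh v ≤ exp (v² / 2)`. -/
lemma sum_signs_exp_le {n : ℕ} (v : Fin n → ℝ) :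
    ∑ σ : Fin n → Bool, Real.exp (∑ i, (if σ i then -v i else v i)) ≤
      2 ^ n * Real.exp (∑ i, v i ^ 2 / 2) := by
  have h : ∑ σ : Fin n → Bool, Real.exp (∑ i, (if σ i then -v i else v i)) =
      ∏ i, (2 * Real.cosh (v i)) := by
    have := Finset.prod_univ_sum (fun _ : Fin n => (Finset.univ : Finset Bool))
      (fun i β => Real.exp (if β then -v i else v i))
    rw [Fintype.piFinset_univ] at this
    simp_rw [Real.exp_sum]
    rw [← this]
    refine Finset.prod_congr rfl fun i _ => ?_
    rw [Fintype.sum_bool, Real.cosh_eq]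
    simp
    ring
  rw [h, Finset.prod_mul_distrib, Finset.prod_const, Finset.card_univ, Fintype.card_fin,
    Real.exp_sum]
  gcongr with i
  exact Real.cosh_le_exp_half_sq _

/-! ### Swaps within the pairs of a double sample -/

section Swap

variable {α : Type*} {n : ℕ}

/-- Swap the two entries of the pairs at the indices selected by `σ`. -/
def swapBy (σ : Fin n → Bool) (p : Fin n → α × α) : Fin n → α × α :=
  fun i => if σ i then (p i).swap else p i

lemma swapBy_involutive (σ : Fin n → Bool) : Function.Involutive (swapBy (α := α) σ) := by
  intro p
  funext i
  by_cases h : σ i <;> simp [swapBy, h]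

lemma measurePreserving_swapBy [MeasurableSpace α] (ν : Measure α) [IsProbabilityMeasure ν]
    (σ : Fin n → Bool) :
    MeasurePreserving (swapBy σ) (Measure.pi fun _ : Fin n => ν.prod ν)
      (Measure.pi fun _ => ν.prod ν) := by
  refine measurePreserving_pi (fun _ => ν.prod ν) (fun _ => ν.prod ν)
    (f := fun i q => if σ i then q.swap else q) fun i => ?_
  by_cases h : σ i
  · simpa [h] using Measure.measurePreserving_swap
  · simpa [h] using! MeasurePreserving.id (ν.prod ν)

end Swap

/-! ### Symmetrization for a fixed double sample -/

section Symmetrization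

variable {X Z : Type*}

/-- The zero-one loss of the label `c` against `y`, counted only on the set `W`. -/
noncomputable def maskedLoss (W : Set Z) (y : Z → Fin 2) (c : Fin 2) (z : Z) : ℝ :=
  W.indicator (fun z => if c = y z then 0 else 1) z

lemma maskedLoss_nonneg (W : Set Z) (y : Z → Fin 2) (c : Fin 2) (z : Z) :
    0 ≤ maskedLoss W y c z := by
  unfold maskedLoss
  refine Set.indicator_nonneg (fun z _ => ?_) z
  split_ifs <;> norm_num

lemma maskedLoss_le (W : Set Z) (y : Z → Fin 2) (c : Fin 2) (z : Z) :
    maskedLoss W y c z ≤ W.indicator 1 z := by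
  unfold maskedLoss
  refine Set.indicator_le_indicator ?_
  split_ifs <;> simp

lemma indicator_one_le_one (W : Set Z) (z : Z) : W.indicator (1 : Z → ℝ) z ≤ 1 :=
  Set.indicator_le_self' (by simp) z

lemma maskedLoss_le_one (W : Set Z) (y : Z → Fin 2) (c : Fin 2) (z : Z) :
    maskedLoss W y c z ≤ 1 :=
  (maskedLoss_le W y c z).trans (indicator_one_le_one W z)

open Classical in
lemma sum_maskedLoss {n : ℕ} (W : Set Z) (y : Z → Fin 2) (c : Fin n → Fin 2) (z : Fin n → Z) :
    ∑ i, maskedLoss W y (c i) (z i) =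
      ((Finset.univ.filter fun i => z i ∈ W ∧ c i ≠ y (z i)).card : ℝ) := by
  rw [Finset.card_filter]
  push_cast
  refine Finset.sum_congr rfl fun i _ => ?_
  by_cases h1 : z i ∈ W <;> by_cases h2 : c i = y (z i) <;> simp [maskedLoss, h1, h2]

/-- The difference of the masked losses over the two entries of a pair labelled by `b`. -/
noncomputable def lossGap (W : Set Z) (y : Z → Fin 2) (b : Fin 2 × Fin 2) (q : Z × Z) : ℝ :=
  maskedLoss W y b.1 q.1 - maskedLoss W y b.2 q.2

lemma lossGap_swap (W : Set Z) (y : Z → Fin 2) (b : Fin 2 × Fin 2) (q : Z × Z) :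
    lossGap W y b.swap q.swap = -lossGap W y b q := by
  simp [lossGap]

/-- The gap is at most one in absolute value and vanishes when neither entry lies in `W`. Hence the
variance proxy counts points of `W` rather than all pairs, which gives `√(d / (P₀ n))` and not `√(d
/ n) / P₀`. -/
lemma lossGap_sq_le (W : Set Z) (y : Z → Fin 2) (b : Fin 2 × Fin 2) (q : Z × Z) :
    lossGap W y b q ^ 2 ≤ W.indicator 1 q.1 + W.indicator 1 q.2 := by
  have h1 := maskedLoss_nonneg W y b.1 q.1
  have h2 := maskedLoss_nonneg W y b.2 q.2
  have h3 := maskedLoss_le W y b.1 q.1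
  have h4 := maskedLoss_le W y b.2 q.2
  have h5 := maskedLoss_le_one W y b.1 q.1
  have h6 := maskedLoss_le_one W y b.2 q.2
  unfold lossGap
  nlinarith

/-- Some hypothesis in `H` labels the inputs of the double sample `p` by `b`. -/
def PairRealizes {n : ℕ} (H : Set (X → Fin 2)) (x : Z → X) (p : Fin n → Z × Z)
    (b : Fin n → Fin 2 × Fin 2) : Prop :=
  ∃ h ∈ H, ∀ i, h (x (p i).1) = (b i).1 ∧ h (x (p i).2) = (b i).2

lemma pairRealizes_iff_realizes {n : ℕ} (H : Set (X → Fin 2)) (x : Z → X) (p : Fin n → Z × Z)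
    (b : Fin n → Fin 2 × Fin 2) :
    PairRealizes H x p b ↔
      Realizes H (Fin.append (fun i => x (p i).1) fun i => x (p i).2)
        (Fin.append (fun i => (b i).1) fun i => (b i).2) := by
  unfold PairRealizes Realizes
  refine exists_congr fun h => and_congr_right fun _ => ?_
  rw [forall_and]
  constructor
  · rintro ⟨h1, h2⟩ i
    refine Fin.addCases (fun i => ?_) (fun i => ?_) i
    · simpa only [Fin.append_left] using h1 i
    · simpa only [Fin.append_right] using h2 i
  · intro hh
    exact ⟨fun i => by simpa only [Fin.append_left] using hh (Fin.castAdd n i),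
      fun i => by simpa only [Fin.append_right] using hh (Fin.natAdd n i)⟩

lemma pairRealizes_swapBy {n : ℕ} (H : Set (X → Fin 2)) (x : Z → X) (σ : Fin n → Bool)
    (p : Fin n → Z × Z) (b : Fin n → Fin 2 × Fin 2) :
    PairRealizes H x (swapBy σ p) (swapBy σ b) ↔ PairRealizes H x p b := by
  unfold PairRealizes
  refine exists_congr fun h => and_congr_right fun _ => forall_congr' fun i => ?_
  by_cases hi : σ i <;> simp [swapBy, hi, and_comm]

open Classical in
lemma card_pairRealizes_le {n d : ℕ} {H : Set (X → Fin 2)} (hd : vcDim H ≤ d) (x : Z → X)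
    (p : Fin n → Z × Z) :
    (Finset.univ.filter (PairRealizes H x p)).card ≤ (2 * n + 1) ^ d := by
  have h := card_realizes_le hd (Fin.append (fun i => x (p i).1) fun i => x (p i).2)
  refine le_trans ?_ (h.trans_eq (by rw [two_mul]))
  refine Finset.card_le_card_of_injOn
    (fun b => Fin.append (fun i => (b i).1) fun i => (b i).2) ?_ ?_
  · intro b hb
    simp only [Finset.coe_filter, Finset.mem_univ, true_and, Set.mem_ofPred_eq] at hb ⊢
    exact (pairRealizes_iff_realizes H x p b).1 hb
  · intro b _ c _ hbc
    funext i
    have h1 := congrFun hbc (Fin.castAdd n i)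
    have h2 := congrFun hbc (Fin.natAdd n i)
    simp only [Fin.append_left, Fin.append_right] at h1 h2
    exact Prod.ext h1 h2

open Classical in
/-- The sum over the labelings `b` of the double sample `p` realised by `H` of
`exp (s * v) + exp (-s * v)`, where `v` is the total loss gap of `b`. -/
noncomputable def patternExp {n : ℕ} (H : Set (X → Fin 2)) (x : Z → X) (W : Set Z) (y : Z → Fin 2)
    (s : ℝ) (p : Fin n → Z × Z) : ENNReal :=
  ∑ b : Fin n → Fin 2 × Fin 2, if PairRealizes H x p b then
    ENNReal.ofReal (Real.exp (∑ i, s * lossGap W y (b i) (p i)) +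
      Real.exp (∑ i, (-s) * lossGap W y (b i) (p i))) else 0

/-- Swapping the labels along with the points permutes the realised labelings, so a swap of the
sample only flips signs of the gaps. Averaging over signs bounds each labeling, and Sauer–Shelah on
`2n` points counts them. -/
lemma sum_swapBy_patternExp_le {n d : ℕ} {H : Set (X → Fin 2)} (hd : vcDim H ≤ d) (x : Z → X)
    (W : Set Z) (y : Z → Fin 2) (s : ℝ) (p : Fin n → Z × Z) :
    ∑ σ : Fin n → Bool, patternExp H x W y s (swapBy σ p) ≤
      ENNReal.ofReal (2 ^ n * (2 * (2 * n + 1) ^ d *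
        Real.exp (∑ i, s ^ 2 / 2 * (W.indicator 1 (p i).1 + W.indicator 1 (p i).2)))) := by
  classical
  set B : ℝ := Real.exp (∑ i, s ^ 2 / 2 * (W.indicator 1 (p i).1 + W.indicator 1 (p i).2)) with hB
  have hswap : ∀ σ : Fin n → Bool, patternExp H x W y s (swapBy σ p) =
      ∑ b : Fin n → Fin 2 × Fin 2, if PairRealizes H x p b then
        ENNReal.ofReal
          (Real.exp (∑ i, if σ i then -(s * lossGap W y (b i) (p i))
            else s * lossGap W y (b i) (p i)) +
          Real.exp (∑ i, if σ i then -(-s * lossGap W y (b i) (p i))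
            else -s * lossGap W y (b i) (p i))) else 0 := by
    intro σ
    unfold patternExp
    rw [← Equiv.sum_comp (swapBy_involutive σ).toPerm]
    refine Finset.sum_congr rfl fun b _ => ?_
    simp only [Function.Involutive.coe_toPerm, pairRealizes_swapBy]
    have hg : ∀ i (r : ℝ), r * lossGap W y (swapBy σ b i) (swapBy σ p i) =
        if σ i then -(r * lossGap W y (b i) (p i)) else r * lossGap W y (b i) (p i) := by
      intro i r
      by_cases hi : σ i
      · simp only [swapBy, hi, if_true, lossGap_swap]; ring
      · simp [swapBy, hi]
    simp_rw [hg]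
  have hb : ∀ (r : ℝ) (b : Fin n → Fin 2 × Fin 2), r ^ 2 = s ^ 2 →
      ∑ σ : Fin n → Bool, Real.exp (∑ i, if σ i then -(r * lossGap W y (b i) (p i))
            else r * lossGap W y (b i) (p i)) ≤ 2 ^ n * B := by
    intro r b hr
    refine (sum_signs_exp_le _).trans ?_
    rw [hB]
    gcongr with i
    rw [mul_pow, hr]
    have := lossGap_sq_le W y (b i) (p i)
    nlinarith [sq_nonneg s]
  simp_rw [hswap]
  rw [Finset.sum_comm]
  calc _ ≤ ∑ b : Fin n → Fin 2 × Fin 2, if PairRealizes H x p b then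
        ENNReal.ofReal (2 ^ n * (2 * B)) else 0 := by
        refine Finset.sum_le_sum fun b _ => ?_
        by_cases hp : PairRealizes H x p b
        · simp only [hp, if_true]
          rw [← ENNReal.ofReal_sum_of_nonneg (fun _ _ => by positivity)]
          refine ENNReal.ofReal_le_ofReal ?_
          rw [Finset.sum_add_distrib]
          linarith [hb s b rfl, hb (-s) b (by ring)]
        · simp [hp]
    _ = ((Finset.univ.filter (PairRealizes H x p)).card : ENNReal) *
          ENNReal.ofReal (2 ^ n * (2 * B)) := by
        rw [← Finset.sum_filter, Finset.sum_const, nsmul_eq_mul]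
    _ ≤ (((2 * n + 1) ^ d : ℕ) : ENNReal) * ENNReal.ofReal (2 ^ n * (2 * B)) := by
        gcongr
        exact card_pairRealizes_le hd x p
    _ = _ := by
        rw [← ENNReal.ofReal_natCast, ← ENNReal.ofReal_mul (by positivity)]
        congr 1
        push_cast
        ring

end Symmetrization

/-! ### Ghost sample and the exponential tail bound -/

section SymmetrizationMeasure

variable {X Z : Type*} [MeasurableSpace X] [MeasurableSpace Z]

lemma measurable_maskedLoss {W : Set Z} (hW : MeasurableSet W) {y : Z → Fin 2} (hy : Measurable y)
    {c : Z → Fin 2} (hc : Measurable c) : Measurable fun z => maskedLoss W y (c z) z := by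
  have : (fun z => maskedLoss W y (c z) z) = W.indicator (fun z => if c z = y z then 0 else 1) := by
    funext z
    by_cases hz : z ∈ W <;> simp [maskedLoss, hz]
  rw [this]
  exact (Measurable.ite (measurableSet_eq_fun hc hy) measurable_const measurable_const).indicator hW

lemma integral_maskedLoss {ν : Measure Z} {W : Set Z} {y : Z → Fin 2}
    (hW : MeasurableSet W) (hy : Measurable y) {c : Z → Fin 2}
    (hc : Measurable c) :
    ∫ u, maskedLoss W y (c u) u ∂ν = ν.real {u | u ∈ W ∧ c u ≠ y u} := by
  have hm : MeasurableSet {u | u ∈ W ∧ c u ≠ y u} := hW.inter (measurableSet_eq_fun hc hy).compl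
  rw [← integral_indicator_one hm]
  congr 1
  funext u
  by_cases h1 : u ∈ W <;> by_cases h2 : c u = y u <;> simp [maskedLoss, h1, h2]

/-- The pattern condition of `MeasurableClass` concerns tuples of inputs; this transports it to
double samples. -/
lemma measurePreserving_append {n : ℕ} (ν : Measure Z) [IsProbabilityMeasure ν] {x : Z → X}
    (hx : Measurable x) :
    MeasurePreserving (fun p : Fin n → Z × Z => Fin.append (fun i => x (p i).1) fun i => x (p i).2)
      (Measure.pi fun _ => ν.prod ν) (Measure.pi fun _ : Fin (n + n) => ν.map x) := by
  have : IsProbabilityMeasure (ν.map x) := Measure.isProbabilityMeasure_map hx.aemeasurable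
  have hm : Measurable (fun p : Fin n → Z × Z =>
      Fin.append (fun i => x (p i).1) fun i => x (p i).2) := by
    refine measurable_pi_lambda _ fun k => ?_
    refine Fin.addCases (fun i => ?_) (fun i => ?_) k
    · simp only [Fin.append_left]; fun_prop
    · simp only [Fin.append_right]; fun_prop
  refine ⟨hm, (Measure.pi_eq fun s hs => ?_).symm⟩
  rw [Measure.map_apply hm (MeasurableSet.univ_pi hs), Fin.prod_univ_add, ← Finset.prod_mul_distrib]
  have : (fun p : Fin n → Z × Z => Fin.append (fun i => x (p i).1) fun i => x (p i).2) ⁻¹'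
      (Set.univ.pi s) = Set.univ.pi fun i =>
        (x ⁻¹' s (Fin.castAdd n i)) ×ˢ (x ⁻¹' s (Fin.natAdd n i)) := by
    ext p
    simp only [Set.mem_preimage, Set.mem_pi, Set.mem_univ, true_imp_iff, Set.mem_prod]
    constructor
    · intro h i
      exact ⟨by simpa only [Fin.append_left] using h (Fin.castAdd n i),
        by simpa only [Fin.append_right] using h (Fin.natAdd n i)⟩
    · intro h k
      refine Fin.addCases (fun i => ?_) (fun i => ?_) k
      · simpa only [Fin.append_left] using (h i).1
      · simpa only [Fin.append_right] using (h i).2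
  rw [this, Measure.pi_pi]
  refine Finset.prod_congr rfl fun i _ => ?_
  rw [Measure.prod_prod, Measure.map_apply hx (hs _), Measure.map_apply hx (hs _)]

variable {H : Set (X → Fin 2)} {ν : Measure Z} [IsProbabilityMeasure ν] {x : Z → X}
  {W : Set Z} {y : Z → Fin 2}

lemma nullMeasurableSet_pairRealizes (hx : Measurable x) (hH : MeasurableClass H (ν.map x))
    {n : ℕ} (b : Fin n → Fin 2 × Fin 2) :
    NullMeasurableSet {p | PairRealizes H x p b} (Measure.pi fun _ => ν.prod ν) := by
  have h := (hH.pattern (n + n) (Fin.append (fun i => (b i).1) fun i => (b i).2)).preimage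
    (measurePreserving_append ν hx).quasiMeasurePreserving
  have e : {p | PairRealizes H x p b} = (fun p : Fin n → Z × Z =>
      Fin.append (fun i => x (p i).1) fun i => x (p i).2) ⁻¹'
      {x | ∃ h ∈ H, ∀ i, h (x i) = Fin.append (fun i => (b i).1) (fun i => (b i).2) i} := by
    ext p
    exact pairRealizes_iff_realizes H x p b
  rw [e]
  exact h

lemma aemeasurable_patternExp (hx : Measurable x) (hH : MeasurableClass H (ν.map x))
    (hW : MeasurableSet W) (hy : Measurable y) (n : ℕ) (s : ℝ) :
    AEMeasurable (patternExp (n := n) H x W y s) (Measure.pi fun _ => ν.prod ν) := by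
  classical
  unfold patternExp
  refine Finset.aemeasurable_fun_sum _ fun b _ => ?_
  have hg : ∀ i, Measurable fun p : Fin n → Z × Z => lossGap W y (b i) (p i) := by
    intro i
    unfold lossGap
    have h1 := measurable_maskedLoss hW hy (measurable_const (a := (b i).1))
    have h2 := measurable_maskedLoss hW hy (measurable_const (a := (b i).2))
    exact (h1.comp (measurable_fst.comp (measurable_pi_apply i))).sub
      (h2.comp (measurable_snd.comp (measurable_pi_apply i)))
  have hm : Measurable fun p : Fin n → Z × Z =>
      ENNReal.ofReal (Real.exp (∑ i, s * lossGap W y (b i) (p i)) +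
      Real.exp (∑ i, (-s) * lossGap W y (b i) (p i))) := by
    fun_prop
  convert hm.aemeasurable.indicator₀ (nullMeasurableSet_pairRealizes (ν := ν) hx hH b) using 1
  funext p
  simp [Set.indicator_apply]

/-- For `0 ≤ c ≤ 1` one has `exp c - 1 ≤ 2c`, and `1 + u ≤ exp u`. -/
lemma integral_exp_indicator_le (hW : MeasurableSet W) {c : ℝ} (hc0 : 0 ≤ c) (hc1 : c ≤ 1) :
    ∫ z, Real.exp (c * W.indicator 1 z) ∂ν ≤ Real.exp (2 * c * ν.real W) := by
  have h1 : ∀ z, Real.exp (c * W.indicator 1 z) = 1 + W.indicator (fun _ => Real.exp c - 1) z := by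
    intro z
    by_cases hz : z ∈ W <;> simp [hz]
  simp_rw [h1]
  rw [integral_add (integrable_const _) ((integrable_const _).indicator hW),
    integral_indicator_const _ hW]
  have h2 : Real.exp c - 1 ≤ 2 * c := by
    have := Real.abs_exp_sub_one_le (x := c) (by rwa [abs_of_nonneg hc0])
    rw [abs_of_nonneg hc0] at this
    exact (le_abs_self _).trans this
  have h3 := Real.add_one_le_exp (2 * c * ν.real W)
  have h4 : 0 ≤ ν.real W := measureReal_nonneg
  simp only [integral_const, probReal_univ, smul_eq_mul, one_mul]
  nlinarith

lemma lintegral_exp_sum_indicator_le (hW : MeasurableSet W) (n : ℕ) {c : ℝ} (hc0 : 0 ≤ c)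
    (hc1 : c ≤ 1) :
    ∫⁻ p : Fin n → Z × Z, ENNReal.ofReal
        (Real.exp (∑ i, c * (W.indicator 1 (p i).1 + W.indicator 1 (p i).2)))
        ∂(Measure.pi fun _ => ν.prod ν) ≤
      ENNReal.ofReal (Real.exp (4 * c * n * ν.real W)) := by
  have hm : Measurable (W.indicator (1 : Z → ℝ)) := measurable_one.indicator hW
  rw [← ofReal_integral_eq_lintegral_ofReal]
  · refine ENNReal.ofReal_le_ofReal ?_
    simp_rw [Real.exp_sum]
    rw [integral_fintype_prod_eq_prod (𝕜 := ℝ)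
      (fun (_ : Fin n) (q : Z × Z) => Real.exp (c * (W.indicator 1 q.1 + W.indicator 1 q.2)))]
    simp_rw [mul_add, Real.exp_add]
    rw [integral_prod_mul (fun z => Real.exp (c * W.indicator 1 z))
      (fun z => Real.exp (c * W.indicator 1 z)), Finset.prod_const, Finset.card_univ,
      Fintype.card_fin]
    have h0 : 0 ≤ ∫ z, Real.exp (c * W.indicator 1 z) ∂ν :=
      integral_nonneg fun z => (Real.exp_pos _).le
    have h1 := integral_exp_indicator_le (ν := ν) hW hc0 hc1
    calc _ ≤ (Real.exp (2 * c * ν.real W) * Real.exp (2 * c * ν.real W)) ^ n := by gcongr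
      _ = _ := by
        rw [← Real.exp_add, ← Real.exp_nat_mul]
        congr 1; ring
  · refine Integrable.of_bound (C := Real.exp (∑ i : Fin n, c * (1 + 1)))
      (by fun_prop) (Filter.Eventually.of_forall fun p => ?_)
    rw [Real.norm_eq_abs, Real.abs_exp]
    gcongr <;> exact indicator_one_le_one W _
  · exact Filter.Eventually.of_forall fun p => (Real.exp_pos _).le

/-- The law of the double sample is invariant under all `2 ^ n` swaps, so the integral equals that
of the average over swaps. -/
lemma lintegral_patternExp_le {d : ℕ} (hd : vcDim H ≤ d) (hx : Measurable x)
    (hH : MeasurableClass H (ν.map x)) (hW : MeasurableSet W) (hy : Measurable y) (n : ℕ)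
    {s : ℝ} (hs : s ^ 2 ≤ 1) :
    ∫⁻ p, patternExp (n := n) H x W y s p ∂(Measure.pi fun _ => ν.prod ν) ≤
      ENNReal.ofReal (2 * (2 * n + 1) ^ d * Real.exp (2 * s ^ 2 * n * ν.real W)) := by
  have hF := aemeasurable_patternExp (ν := ν) hx hH hW hy n s
  have hσ : ∀ σ : Fin n → Bool,
      ∫⁻ p, patternExp H x W y s (swapBy σ p) ∂(Measure.pi fun _ => ν.prod ν) =
      ∫⁻ p, patternExp (n := n) H x W y s p ∂(Measure.pi fun _ => ν.prod ν) := by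
    intro σ
    have hT := measurePreserving_swapBy ν σ
    conv_rhs => rw [← hT.map_eq]
    rw [lintegral_map' (by rwa [hT.map_eq]) hT.aemeasurable]
  have hsum : (2 ^ n : ENNReal) * ∫⁻ p, patternExp (n := n) H x W y s p
        ∂(Measure.pi fun _ => ν.prod ν) =
      ∫⁻ p, ∑ σ : Fin n → Bool, patternExp H x W y s (swapBy σ p)
        ∂(Measure.pi fun _ => ν.prod ν) := by
    have hFσ : ∀ σ ∈ (Finset.univ : Finset (Fin n → Bool)),
        AEMeasurable (fun p => patternExp H x W y s (swapBy σ p))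
          (Measure.pi fun _ => ν.prod ν) := fun σ _ =>
      hF.comp_quasiMeasurePreserving (measurePreserving_swapBy ν σ).quasiMeasurePreserving
    rw [lintegral_finsetSum' _ hFσ]
    simp [hσ]
  have hle : (2 ^ n : ENNReal) * ∫⁻ p, patternExp (n := n) H x W y s p
        ∂(Measure.pi fun _ => ν.prod ν) ≤ (2 ^ n : ENNReal) *
      ENNReal.ofReal (2 * (2 * n + 1) ^ d * Real.exp (2 * s ^ 2 * n * ν.real W)) := by
    rw [hsum]
    refine (lintegral_mono fun p => sum_swapBy_patternExp_le hd x W y s p).trans ?_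
    simp_rw [ENNReal.ofReal_mul (show (0 : ℝ) ≤ 2 ^ n by positivity),
      ENNReal.ofReal_mul (show (0 : ℝ) ≤ 2 * (2 * n + 1) ^ d by positivity)]
    rw [lintegral_const_mul' _ _ ENNReal.ofReal_ne_top,
      lintegral_const_mul' _ _ ENNReal.ofReal_ne_top]
    rw [ENNReal.ofReal_pow (by norm_num), ENNReal.ofReal_ofNat]
    gcongr
    refine (lintegral_exp_sum_indicator_le hW n (by positivity) (by linarith)).trans_eq ?_
    congr 2
    ring
  exact (ENNReal.mul_le_mul_iff_right (by simp) (by simp)).1 hle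

/-- The deviation is the mean over a ghost sample `z'` of the difference of the two sums; Jensen
moves the exponential inside. The labeling by `h` itself is one term of `patternExp`, whose two
exponentials cover both signs. -/
lemma exp_abs_deviation_le_lintegral (hx : Measurable x) (hH : MeasurableClass H (ν.map x))
    (hW : MeasurableSet W) (hy : Measurable y) {n : ℕ} {s : ℝ} (hs : 0 ≤ s)
    {h : X → Fin 2} (hh : h ∈ H) (z : Fin n → Z) :
    ENNReal.ofReal (Real.exp (s * |∑ i, maskedLoss W y (h (x (z i))) (z i) -
        n * ∫ u, maskedLoss W y (h (x u)) u ∂ν|)) ≤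
      ∫⁻ z', patternExp H x W y s (fun i => (z i, z' i)) ∂(Measure.pi fun _ : Fin n => ν) := by
  classical
  set g : Z → ℝ := fun u => maskedLoss W y (h (x u)) u with hg
  have hgm : Measurable g := measurable_maskedLoss hW hy ((hH.measurable h hh).comp hx)
  have hgb : ∀ u, ‖g u‖ ≤ 1 := fun u => by
    rw [Real.norm_eq_abs, abs_of_nonneg (maskedLoss_nonneg _ _ _ _)]
    exact maskedLoss_le_one _ _ _ _
  have hgi : Integrable g ν :=
    Integrable.of_bound hgm.aestronglyMeasurable (C := 1) (Filter.Eventually.of_forall hgb)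
  set V : (Fin n → Z) → ℝ := fun z' => ∑ i, g (z i) - ∑ i, g (z' i) with hV
  have hVm : Measurable V := by fun_prop
  have hVb : ∀ z', |V z'| ≤ 2 * n := by
    intro z'
    have h1 : ∀ z'' : Fin n → Z, |∑ i, g (z'' i)| ≤ n := fun z'' =>
      (Finset.abs_sum_le_sum_abs _ _).trans
        ((Finset.sum_le_sum fun i _ => hgb (z'' i)).trans_eq (by simp))
    have := abs_sub (∑ i, g (z i)) (∑ i, g (z' i))
    linarith [h1 z, h1 z']
  have hVi : Integrable V (Measure.pi fun _ : Fin n => ν) :=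
    Integrable.of_bound hVm.aestronglyMeasurable (C := 2 * n) (Filter.Eventually.of_forall hVb)
  have hVE : ∫ z', V z' ∂(Measure.pi fun _ : Fin n => ν) = ∑ i, g (z i) - n * ∫ u, g u ∂ν := by
    have hi : ∀ i : Fin n, Integrable (fun z' : Fin n → Z => g (z' i))
        (Measure.pi fun _ : Fin n => ν) := fun i =>
      integrable_comp_eval (μ := fun _ : Fin n => ν) (i := i) hgi
    rw [hV, integral_sub (integrable_const _) (integrable_finsetSum _ fun i _ => hi i),
      integral_finsetSum _ fun i _ => hi i]
    have : ∀ i : Fin n, ∫ z' : Fin n → Z, g (z' i) ∂(Measure.pi fun _ : Fin n => ν) =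
        ∫ u, g u ∂ν := fun i =>
      integral_comp_eval (μ := fun _ : Fin n => ν) (i := i) hgm.aestronglyMeasurable
    simp [this]
  have hEi : Integrable (fun z' => Real.exp (s * |V z'|)) (Measure.pi fun _ : Fin n => ν) := by
    refine Integrable.of_bound (by fun_prop) (C := Real.exp (s * (2 * n)))
      (Filter.Eventually.of_forall fun z' => ?_)
    rw [Real.norm_eq_abs, Real.abs_exp]
    gcongr
    exact hVb z'
  have hJ : Real.exp (s * |∑ i, g (z i) - n * ∫ u, g u ∂ν|) ≤
      ∫ z', Real.exp (s * |V z'|) ∂(Measure.pi fun _ : Fin n => ν) := by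
    have h1 := ConvexOn.map_integral_le (μ := Measure.pi fun _ : Fin n => ν)
      (f := fun z' => s * |V z'|) convexOn_exp Real.continuous_exp.continuousOn isClosed_univ
      (by simp) (hVi.abs.const_mul s) hEi
    refine le_trans ?_ h1
    rw [Real.exp_le_exp, integral_const_mul, ← hVE]
    gcongr
    exact abs_integral_le_integral_abs
  refine (ENNReal.ofReal_le_ofReal hJ).trans ?_
  rw [ofReal_integral_eq_lintegral_ofReal hEi
    (Filter.Eventually.of_forall fun _ => (Real.exp_pos _).le)]
  refine lintegral_mono fun z' => ?_
  have hb : PairRealizes H x (fun i => (z i, z' i)) fun i => (h (x (z i)), h (x (z' i))) :=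
    ⟨h, hh, fun i => ⟨rfl, rfl⟩⟩
  have hVe : ∀ r : ℝ, ∑ i, r * lossGap W y (h (x (z i)), h (x (z' i))) (z i, z' i) = r * V z' := by
    intro r
    rw [← Finset.mul_sum, hV]
    simp [lossGap, hg]
  unfold patternExp
  refine le_trans ?_ (Finset.single_le_sum (fun _ _ => zero_le)
    (Finset.mem_univ fun i => (h (x (z i)), h (x (z' i)))))
  rw [if_pos hb, hVe, hVe]
  refine ENNReal.ofReal_le_ofReal ?_
  have e1 := Real.exp_pos (s * V z')
  have e2 := Real.exp_pos (-s * V z')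
  rcases abs_cases (V z') with ⟨h1, _⟩ | ⟨h1, _⟩
  · rw [h1]; linarith
  · rw [h1, mul_neg, ← neg_mul]; linarith

/-- The exponential tail bound for the uniform deviation over a VC class; the left-hand side is an
outer measure. -/
lemma measure_exists_deviation_le {d : ℕ} (hd : vcDim H ≤ d) (hx : Measurable x)
    (hH : MeasurableClass H (ν.map x)) (hW : MeasurableSet W) (hy : Measurable y) (n : ℕ)
    {s : ℝ} (hs0 : 0 ≤ s) (hs : s ≤ 1) (t : ℝ) :
    (Measure.pi fun _ : Fin n => ν) {z | ∃ h ∈ H,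
        t ≤ |∑ i, maskedLoss W y (h (x (z i))) (z i) - n * ∫ u, maskedLoss W y (h (x u)) u ∂ν|} ≤
      ENNReal.ofReal (2 * (2 * n + 1) ^ d * Real.exp (2 * s ^ 2 * n * ν.real W - s * t)) := by
  have hF := aemeasurable_patternExp (ν := ν) hx hH hW hy n s
  have hT := (measurePreserving_arrowProdEquivProdArrow Z Z (Fin n) (fun _ => ν)
    (fun _ => ν)).symm
  have hF2 : AEMeasurable (fun q : (Fin n → Z) × (Fin n → Z) =>
      patternExp H x W y s (fun i => (q.1 i, q.2 i)))
      ((Measure.pi fun _ : Fin n => ν).prod (Measure.pi fun _ : Fin n => ν)) :=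
    hF.comp_quasiMeasurePreserving hT.quasiMeasurePreserving
  have hFub : ∫⁻ z, ∫⁻ z', patternExp H x W y s (fun i => (z i, z' i))
        ∂(Measure.pi fun _ : Fin n => ν) ∂(Measure.pi fun _ : Fin n => ν) =
      ∫⁻ p, patternExp (n := n) H x W y s p ∂(Measure.pi fun _ => ν.prod ν) := by
    rw [← lintegral_prod _ hF2, ← hT.map_eq, lintegral_map' (by rwa [hT.map_eq]) hT.aemeasurable]
    rfl
  -- Markov's inequality for the a.e. measurable majorant; the deviation set, perhaps not
  -- measurable, is contained in its superlevel set.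
  have hM := mul_meas_ge_le_lintegral₀ hF2.lintegral_prod_right' (ENNReal.ofReal (Real.exp (s * t)))
  rw [hFub] at hM
  have hM2 := hM.trans (lintegral_patternExp_le hd hx hH hW hy n (by nlinarith))
  have hsub : {z : Fin n → Z | ∃ h ∈ H,
        t ≤ |∑ i, maskedLoss W y (h (x (z i))) (z i) - n * ∫ u, maskedLoss W y (h (x u)) u ∂ν|} ⊆
      {z | ENNReal.ofReal (Real.exp (s * t)) ≤
        ∫⁻ z', patternExp H x W y s (fun i => (z i, z' i)) ∂(Measure.pi fun _ : Fin n => ν)} := by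
    rintro z ⟨h, hh, ht⟩
    refine le_trans (ENNReal.ofReal_le_ofReal ?_)
      (exp_abs_deviation_le_lintegral (ν := ν) hx hH hW hy hs0 hh z)
    gcongr
  refine (measure_mono hsub).trans ?_
  have hpos : ENNReal.ofReal (Real.exp (s * t)) ≠ 0 := by
    simpa using Real.exp_pos (s * t)
  rw [← ENNReal.mul_le_mul_iff_right hpos ENNReal.ofReal_ne_top]
  refine hM2.trans_eq ?_
  rw [← ENNReal.ofReal_mul (Real.exp_pos _).le]
  congr 1
  rw [Real.exp_sub]
  field_simp

end SymmetrizationMeasure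

/-! ### Choice of parameters -/

section Calibration

lemma log_two_mul_div_pos {n : ℕ} (hn : 1 ≤ n) {δ : ℝ} (hδ0 : 0 < δ) (hδ1 : δ < 1) :
    0 < Real.log (2 * n / δ) := by
  have hn' : (1 : ℝ) ≤ n := by exact_mod_cast hn
  refine Real.log_pos ?_
  rw [lt_div_iff₀ hδ0]
  linarith

/-- With `D = d log(2n/δ)`, one `D` of the exponent absorbs the factor 2, two absorb `(2n + 1) ^ d`,
and the remaining three leave at most `(δ / 2) ^ 3`. -/
lemma growth_mul_exp_le {n d : ℕ} (hn : 1 ≤ n) (hd : 1 ≤ d) {δ : ℝ} (hδ0 : 0 < δ) (hδ1 : δ < 1) :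
    2 * (2 * n + 1 : ℝ) ^ d * Real.exp (-(6 * (d * Real.log (2 * n / δ)))) ≤ δ / 8 := by
  have hn' : (1 : ℝ) ≤ n := by exact_mod_cast hn
  have hd' : (1 : ℝ) ≤ d := by exact_mod_cast hd
  have hL := log_two_mul_div_pos hn hδ0 hδ1
  set L := Real.log (2 * n / δ) with hLdef
  have hpos : (0 : ℝ) < 2 * n / δ := by positivity
  have hexpL : Real.exp L = 2 * n / δ := Real.exp_log hpos
  have h2n : 2 * (n : ℝ) ≤ Real.exp L := by
    rw [hexpL, le_div_iff₀ hδ0]; nlinarith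
  have hLd : L ≤ d * L := by nlinarith
  have h1 : (2 : ℝ) ≤ Real.exp (d * L) := by
    have := Real.exp_le_exp.2 hLd
    linarith
  have h2 : (2 * n + 1 : ℝ) ^ d ≤ Real.exp (2 * (d * L)) := by
    have : (2 * n + 1 : ℝ) ≤ Real.exp (2 * L) := by
      rw [two_mul L, Real.exp_add]
      nlinarith
    calc (2 * n + 1 : ℝ) ^ d ≤ Real.exp (2 * L) ^ d := by gcongr
      _ = _ := by rw [← Real.exp_nat_mul]; congr 1; ring
  have h3 : Real.exp (-(3 * (d * L))) ≤ δ / 8 := by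
    have e : Real.exp (-(3 * L)) = (δ / (2 * n)) ^ 3 := by
      rw [Real.exp_neg, show 3 * L = (3 : ℕ) * L by norm_num, Real.exp_nat_mul, hexpL, ← inv_pow,
        inv_div]
    have e2 : δ / (2 * n) ≤ δ / 2 := by gcongr; linarith
    calc Real.exp (-(3 * (d * L))) ≤ Real.exp (-(3 * L)) := by
          apply Real.exp_le_exp.2; linarith
      _ ≤ (δ / 2) ^ 3 := by rw [e]; gcongr
      _ ≤ δ / 8 := by
        have : δ ^ 3 ≤ δ := by
          nlinarith [mul_pos hδ0 hδ0, mul_pos (mul_pos hδ0 hδ0) hδ0]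
        nlinarith
  calc 2 * (2 * n + 1 : ℝ) ^ d * Real.exp (-(6 * (d * L)))
      ≤ Real.exp (d * L) * Real.exp (2 * (d * L)) * Real.exp (-(6 * (d * L))) := by gcongr
    _ = Real.exp (-(3 * (d * L))) := by
      rw [← Real.exp_add, ← Real.exp_add]; congr 1; ring
    _ ≤ δ / 8 := h3

variable {X Z : Type*} [MeasurableSpace X] [MeasurableSpace Z]
  {H : Set (X → Fin 2)} {ν : Measure Z} [IsProbabilityMeasure ν] {x : Z → X}
  {W : Set Z} {y : Z → Fin 2}

lemma measure_exists_deviation_le_confidence {d : ℕ} (hd : vcDim H ≤ d) (hd1 : 1 ≤ d)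
    (hx : Measurable x) (hH : MeasurableClass H (ν.map x)) (hW : MeasurableSet W)
    (hy : Measurable y) {n : ℕ} (hn : 1 ≤ n) {δ : ℝ} (hδ0 : 0 < δ) (hδ1 : δ < 1)
    (hlarge : d * Real.log (2 * n / δ) ≤ n * ν.real W) :
    (Measure.pi fun _ : Fin n => ν) {z | ∃ h ∈ H,
        8 * √(n * ν.real W * (d * Real.log (2 * n / δ))) ≤
          |∑ i, maskedLoss W y (h (x (z i))) (z i) - n * ∫ u, maskedLoss W y (h (x u)) u ∂ν|} ≤
      ENNReal.ofReal (δ / 8) := by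
  have hL := log_two_mul_div_pos hn hδ0 hδ1
  have hd' : (1 : ℝ) ≤ d := by exact_mod_cast hd1
  set D := d * Real.log (2 * n / δ) with hD
  have hD0 : 0 < D := by positivity
  set N := n * ν.real W with hN
  have hN0 : 0 < N := hD0.trans_le hlarge
  -- At `s = √(D/N)` and `t = 8√(ND)` the exponent `2s²N - st` equals `-6D`; `hlarge` is exactly `s
  -- ≤ 1`.
  refine (measure_exists_deviation_le hd hx hH hW hy n (s := √(D / N)) (Real.sqrt_nonneg _)
    (Real.sqrt_le_one.2 ((div_le_one hN0).2 hlarge)) _).trans (ENNReal.ofReal_le_ofReal ?_)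
  refine le_trans (le_of_eq ?_) (growth_mul_exp_le hn hd1 hδ0 hδ1)
  congr 2
  have h1 : √(D / N) ^ 2 = D / N := Real.sq_sqrt (by positivity)
  have h2 : √(D / N) * √(N * D) = D := by
    rw [← Real.sqrt_mul (by positivity), show D / N * (N * D) = D ^ 2 by field_simp]
    exact Real.sqrt_sq hD0.le
  calc 2 * √(D / N) ^ 2 * n * ν.real W - √(D / N) * (8 * √(N * D))
      = 2 * √(D / N) ^ 2 * N - 8 * (√(D / N) * √(N * D)) := by rw [hN]; ring
    _ = -(6 * D) := by rw [h1, h2]; field_simp; ring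

end Calibration

/-! ### Joint law of points and marks; number of marks -/

section Sampling

lemma MaliciousSampling.measurable_pair {X Ω : Type*} [MeasurableSpace X]
    [MeasurableSpace Ω] {n : ℕ} {P : Measure (DataPoint X)} {α : ℝ} {μ : Measure Ω}
    {clean : Ω → Dataset X n} {marked : Ω → Fin n → Bool} {corrupted : Ω → Dataset X n}
    (hS : MaliciousSampling P α μ clean marked corrupted) :
    Measurable fun ω i => (clean ω i, marked ω i) :=
  measurable_pi_lambda _ fun i => ((measurable_pi_apply i).comp hS.measurable_clean).prodMk
    ((measurable_pi_apply i).comp hS.measurable_marked)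

variable {X Ω : Type*} [MeasurableSpace X] [MeasurableSpace Ω] {n : ℕ}
  {P : Measure (DataPoint X)} {α : ℝ} {μ : Measure Ω}
  [IsProbabilityMeasure μ] {clean : Ω → Dataset X n} {marked : Ω → Fin n → Bool}
  {corrupted : Ω → Dataset X n}

lemma ext_of_real_singleton_true {β β' : Measure Bool} [IsProbabilityMeasure β]
    [IsProbabilityMeasure β'] (h : β.real {true} = β'.real {true}) : β = β' := by
  have ht : β {true} = β' {true} := (measureReal_eq_measureReal_iff).1 h
  refine Measure.ext_of_singleton fun b => ?_
  cases b
  · have hc : ({false} : Set Bool) = {true}ᶜ := by ext b; cases b <;> simp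
    rw [hc, prob_compl_eq_one_sub (by simp), prob_compl_eq_one_sub (by simp), ht]
  · exact ht

/-- Makes being unmarked an event about a single i.i.d. pair, so it can be part of the mask `W`. -/
lemma MaliciousSampling.exists_map_eq_pi [IsProbabilityMeasure P]
    (hS : MaliciousSampling P α μ clean marked corrupted) (hn : 1 ≤ n) :
    ∃ β : Measure Bool, IsProbabilityMeasure β ∧ β.real {false} = 1 - α ∧
      μ.map (fun ω i => (clean ω i, marked ω i)) = Measure.pi fun _ : Fin n => P.prod β := by
  have hmc : ∀ i, Measurable fun ω => clean ω i := fun i =>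
    (measurable_pi_apply i).comp hS.measurable_clean
  have hmm : ∀ i, Measurable fun ω => marked ω i := fun i =>
    (measurable_pi_apply i).comp hS.measurable_marked
  have hp : ∀ i, IsProbabilityMeasure (μ.map fun ω => marked ω i) := fun i =>
    Measure.isProbabilityMeasure_map (hmm i).aemeasurable
  have ht : ∀ i, (μ.map fun ω => marked ω i).real {true} = α := by
    intro i
    rw [map_measureReal_apply (hmm i) (by simp)]
    exact hS.marked_prob i
  let i₀ : Fin n := ⟨0, hn⟩
  refine ⟨μ.map fun ω => marked ω i₀, hp i₀, ?_, ?_⟩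
  · have hc : ({false} : Set Bool) = {true}ᶜ := by ext b; cases b <;> simp
    rw [hc, probReal_compl_eq_one_sub (by simp), ht]
  · have hβ : ∀ i, μ.map (fun ω => marked ω i) = μ.map fun ω => marked ω i₀ := fun i =>
      ext_of_real_singleton_true (by rw [ht, ht])
    have h1 : μ.map clean = Measure.pi fun _ : Fin n => P := by
      have := (iIndepFun_iff_map_fun_eq_pi_map fun i => (hmc i).aemeasurable).1 hS.clean_indep
      simp_rw [hS.clean_law] at this
      exact this
    have h2 : μ.map marked = Measure.pi fun _ : Fin n => μ.map fun ω => marked ω i₀ := by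
      have := (iIndepFun_iff_map_fun_eq_pi_map fun i => (hmm i).aemeasurable).1 hS.marked_indep
      simp_rw [hβ] at this
      exact this
    have h3 := (indepFun_iff_map_prod_eq_prod_map_map hS.measurable_clean.aemeasurable
      hS.measurable_marked.aemeasurable).1 hS.clean_marked_indep
    have hT := (measurePreserving_arrowProdEquivProdArrow (DataPoint X) Bool (Fin n) (fun _ => P)
      (fun _ => μ.map fun ω => marked ω i₀)).symm
    rw [h1, h2] at h3
    rw [← hT.map_eq, ← h3,
      Measure.map_map hT.measurable (hS.measurable_clean.prodMk hS.measurable_marked)]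
    rfl

/-- The number of marks exceeds its mean by one half only with small probability. -/
lemma MaliciousSampling.measure_marks_gt_le (hS : MaliciousSampling P α μ clean marked corrupted)
    (hα : 0 ≤ α) {δ : ℝ} (hδ0 : 0 < δ) (hn : 12 * Real.log (12 / δ) / α ≤ n) :
    μ {ω | 3 / 2 * α * n < ((Finset.univ.filter fun i => marked ω i = true).card : ℝ)} ≤
      ENNReal.ofReal (δ / 12) := by
  have hmm : ∀ i, Measurable fun ω => marked ω i := fun i =>
    (measurable_pi_apply i).comp hS.measurable_marked
  have hset : ∀ i, MeasurableSet {ω | marked ω i = true} := fun i =>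
    hmm i (measurableSet_singleton true)
  -- For `α = 0` the quotient in `hn` is `0`, so `hn` says nothing; but then almost surely no index
  -- is marked.
  rcases hα.eq_or_lt with rfl | hα
  · refine (measure_mono_null (t := ⋃ i, {ω | marked ω i = true}) ?_ ?_).trans_le (zero_le)
    · intro ω hω
      simp only [mul_zero, zero_mul, Set.mem_ofPred_eq, Nat.cast_pos, Finset.card_pos] at hω
      obtain ⟨i, hi⟩ := hω
      exact Set.mem_iUnion.2 ⟨i, (Finset.mem_filter.1 hi).2⟩
    · refine measure_iUnion_null fun i => ?_
      exact (measureReal_eq_zero_iff).1 (hS.marked_prob i)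
  · set f : Bool → ℝ := fun b => if b then 1 else 0 with hf
    set Y : Fin n → Ω → ℝ := fun i ω => f (marked ω i) with hY
    have hYm : ∀ i, Measurable (Y i) := fun i => (measurable_of_countable f).comp (hmm i)
    have hYind : iIndepFun Y μ := hS.marked_indep.comp (fun _ => f) fun _ => measurable_of_countable f
    have hcard : ∀ ω, ((Finset.univ.filter fun i => marked ω i = true).card : ℝ) =
        (∑ i, Y i) ω := by
      intro ω
      rw [Finset.card_filter, Finset.sum_apply]
      push_cast
      rfl
    -- Chernoff at `1/2`: since `exp (1/2) - 1 ≤ 2/3`, the exponent is `(2/3 - 3/4) αn = -αn/12`.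
    have hmgf : ∀ i, mgf (Y i) μ (1 / 2) ≤ Real.exp (2 / 3 * α) := by
      intro i
      have e : ∀ ω, Real.exp (1 / 2 * Y i ω) =
          1 + {ω | marked ω i = true}.indicator (fun _ => Real.exp (1 / 2) - 1) ω := by
        intro ω
        by_cases h : marked ω i = true <;> simp [hY, hf, h]
      unfold mgf
      simp_rw [e]
      rw [integral_add (integrable_const _) ((integrable_const _).indicator (hset i)),
        integral_indicator_const _ (hset i), hS.marked_prob i]
      have h1 : Real.exp (1 / 2) ≤ 5 / 3 := by
        have h2 : Real.exp (1 / 2) ^ 2 = Real.exp 1 := by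
          rw [← Real.exp_nat_mul]; norm_num
        have := Real.exp_one_lt_d9
        nlinarith [Real.exp_pos (1 / 2)]
      have h3 := Real.add_one_le_exp (2 / 3 * α)
      simp only [integral_const, probReal_univ, smul_eq_mul, one_mul]
      nlinarith
    have hsum : mgf (∑ i, Y i) μ (1 / 2) ≤ Real.exp (2 / 3 * α * n) := by
      rw [hYind.mgf_sum hYm]
      calc ∏ i, mgf (Y i) μ (1 / 2) ≤ ∏ _i : Fin n, Real.exp (2 / 3 * α) :=
            Finset.prod_le_prod (fun i _ => mgf_nonneg) fun i _ => hmgf i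
        _ = _ := by
          rw [Finset.prod_const, Finset.card_univ, Fintype.card_fin, ← Real.exp_nat_mul]
          congr 1; ring
    have hint : Integrable (fun ω => Real.exp (1 / 2 * (∑ i, Y i) ω)) μ := by
      refine Integrable.of_bound (C := Real.exp (1 / 2 * n)) ?_
        (Filter.Eventually.of_forall fun ω => ?_)
      · simp only [Finset.sum_apply]
        exact (((Finset.measurable_sum _ fun i _ => hYm i).const_mul _).exp).aestronglyMeasurable
      · rw [Real.norm_eq_abs, Real.abs_exp, ← hcard]
        gcongr
        simpa using Finset.card_le_univ (Finset.univ.filter fun i => marked ω i = true)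
    have hch := measure_ge_le_exp_mul_mgf (μ := μ) (X := ∑ i, Y i) (t := 1 / 2) (3 / 2 * α * n)
      (by norm_num) hint
    have hfin : μ.real {ω | 3 / 2 * α * n ≤ (∑ i, Y i) ω} ≤ δ / 12 := by
      refine hch.trans ?_
      calc _ ≤ Real.exp (-(1 / 2) * (3 / 2 * α * n)) * Real.exp (2 / 3 * α * n) := by gcongr
        _ = Real.exp (-(α * n / 12)) := by rw [← Real.exp_add]; congr 1; ring
        _ ≤ Real.exp (-Real.log (12 / δ)) := by
          rw [div_le_iff₀ hα] at hn
          apply Real.exp_le_exp.2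
          linarith
        _ = δ / 12 := by rw [Real.exp_neg, Real.exp_log (by positivity), inv_div]
    rw [← ENNReal.ofReal_toReal (measure_ne_top μ _)]
    refine ENNReal.ofReal_le_ofReal (le_trans ?_ hfin)
    refine measureReal_mono fun ω hω => ?_
    simp only [Set.mem_ofPred_eq, hcard] at hω ⊢
    exact hω.le

end Sampling

/-! ### Effect of the corruption; ratios of counts -/

section Deterministic

variable {X : Type*} {n : ℕ}

lemma abs_empRisk_sub_le {S S' : Dataset X n} {m : Fin n → Bool}
    (hSS : ∀ i, m i = false → S' i = S i) (h : X → Fin 2) :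
    |empRisk S' h - empRisk S h| ≤ ((Finset.univ.filter fun i => m i = true).card : ℝ) / n := by
  have key : ∀ T T' : Dataset X n, (∀ i, m i = false → T' i = T i) →
      ((Finset.univ.filter fun i => h (T' i).1 ≠ (T' i).2.2).card : ℝ) ≤
        (Finset.univ.filter fun i => h (T i).1 ≠ (T i).2.2).card +
          (Finset.univ.filter fun i => m i = true).card := by
    intro T T' hT
    refine (Nat.cast_le.2 (Finset.card_le_card (t := (Finset.univ.filter fun i =>
      h (T i).1 ≠ (T i).2.2) ∪ Finset.univ.filter fun i => m i = true) fun i hi => ?_)).trans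
      (by exact_mod_cast Finset.card_union_le _ _)
    simp only [Finset.mem_union, Finset.mem_filter, Finset.mem_univ, true_and] at hi ⊢
    cases hm : m i
    · left; rwa [← hT i hm]
    · right; rfl
  have h1 := key S S' hSS
  have h2 := key S' S fun i hi => (hSS i hi).symm
  unfold empRisk
  rw [← sub_div, abs_div, Nat.abs_cast]
  gcongr
  rw [abs_le]
  constructor <;> linarith

/-- The number of unmarked points of group `a`. -/
def unmarkedCount (S : Dataset X n) (m : Fin n → Bool) (a : Fin 2) : ℕ :=
  (Finset.univ.filter fun i => (S i).2.1 = a ∧ m i = false).card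

/-- The number of unmarked points of group `a` that `h` maps to `1`. -/
def unmarkedPositives (S : Dataset X n) (m : Fin n → Bool) (h : X → Fin 2) (a : Fin 2) : ℕ :=
  (Finset.univ.filter fun i => ((S i).2.1 = a ∧ m i = false) ∧ h (S i).1 = 1).card

/-- The number of marked points of group `a`. -/
def markedCount (S : Dataset X n) (m : Fin n → Bool) (a : Fin 2) : ℕ :=
  (Finset.univ.filter fun i => (S i).2.1 = a ∧ m i = true).card

lemma markedCount_zero_add_one (S : Dataset X n) (m : Fin n → Bool) :
    markedCount S m 0 + markedCount S m 1 = (Finset.univ.filter fun i => m i = true).card := by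
  unfold markedCount
  rw [← Finset.card_union_of_disjoint]
  · congr 1
    ext i
    simp only [Finset.mem_union, Finset.mem_filter, Finset.mem_univ, true_and]
    have : (S i).2.1 = 0 ∨ (S i).2.1 = 1 := by omega
    tauto
  · rw [Finset.disjoint_filter]
    rintro i - ⟨h1, -⟩ ⟨h2, -⟩
    rw [h1] at h2
    exact absurd h2 (by decide)

/-- The first ratio mixes `k / c` and `j / e`, both in `[0, 1]`, with weight `e / (c + e)` on the
latter. The algebra avoids `j / e`, so `e = 0` is allowed. -/
lemma abs_div_sub_div_le {k j c e : ℝ} (hk0 : 0 ≤ k) (hkc : k ≤ c) (hj0 : 0 ≤ j) (hje : j ≤ e)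
    (hc : 0 < c) : |(k + j) / (c + e) - k / c| ≤ e / (c + e) := by
  have he : 0 ≤ e := hj0.trans hje
  have hce : 0 < c + e := by linarith
  have h1 : k / c ≤ 1 := (div_le_one hc).2 hkc
  have h0 : 0 ≤ k / c := by positivity
  have e1 : (k + j) / (c + e) - k / c = (j - k / c * e) / (c + e) := by field_simp; ring
  rw [e1, abs_div, abs_of_pos hce]
  gcongr
  rw [abs_le]
  constructor <;> nlinarith

/-- Marked points are counted in `S'`, since the adversary also chooses their group. -/
lemma abs_empPositiveRate_sub_le {S S' : Dataset X n} {m : Fin n → Bool}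
    (hSS : ∀ i, m i = false → S' i = S i) (h : X → Fin 2) (a : Fin 2)
    (hc : 0 < unmarkedCount S m a) :
    |empPositiveRate S' h a - (unmarkedPositives S m h a : ℝ) / unmarkedCount S m a| ≤
      (markedCount S' m a : ℝ) / (unmarkedCount S m a + markedCount S' m a) := by
  set J := (Finset.univ.filter fun i => ((S' i).2.1 = a ∧ m i = true) ∧ h (S' i).1 = 1) with hJ
  have h1 : (Finset.univ.filter fun i => (S' i).2.1 = a).card =
      unmarkedCount S m a + markedCount S' m a := by
    unfold unmarkedCount markedCount
    rw [← Finset.card_union_of_disjoint]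
    · congr 1
      ext i
      simp only [Finset.mem_union, Finset.mem_filter, Finset.mem_univ, true_and]
      cases hm : m i
      · simp [hSS i hm]
      · simp
    · rw [Finset.disjoint_filter]
      rintro i - ⟨-, h1⟩ ⟨-, h2⟩
      simp [h1] at h2
  have h2 : (Finset.univ.filter fun i => h (S' i).1 = 1 ∧ (S' i).2.1 = a).card =
      unmarkedPositives S m h a + J.card := by
    unfold unmarkedPositives
    rw [← Finset.card_union_of_disjoint]
    · congr 1
      ext i
      simp only [hJ, Finset.mem_union, Finset.mem_filter, Finset.mem_univ, true_and]
      cases hm : m i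
      · simp [hSS i hm, and_comm]
      · simp [and_comm]
    · rw [Finset.disjoint_filter]
      rintro i - ⟨⟨-, h1⟩, -⟩ ⟨⟨-, h2⟩, -⟩
      simp [h1] at h2
  have h3 : unmarkedPositives S m h a ≤ unmarkedCount S m a :=
    Finset.card_le_card fun i hi => by
      simp only [Finset.mem_filter, Finset.mem_univ, true_and] at hi ⊢
      exact hi.1
  have h4 : J.card ≤ markedCount S' m a :=
    Finset.card_le_card fun i hi => by
      simp only [hJ, Finset.mem_filter, Finset.mem_univ, true_and] at hi ⊢
      exact hi.1
  unfold empPositiveRate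
  rw [h1, h2]
  push_cast
  exact abs_div_sub_div_le (by positivity) (by exact_mod_cast h3) (by positivity)
    (by exact_mod_cast h4) (by exact_mod_cast hc)

/-- As `1 - α > 1/2`, both counts are at least `c = pN/4`. By concavity of `m / (c + m)` the even
split is worst, giving `2M / (2c + M)`; at `M = 3αN/2` this equals `deltaPar α p`. -/
lemma div_add_div_le_deltaPar {c₀ c₁ m₀ m₁ α p N : ℝ} (hp : 0 < p) (hN : 0 < N) (hα : 0 ≤ α)
    (hα' : α < 1 / 2) (hm₀ : 0 ≤ m₀) (hm₁ : 0 ≤ m₁) (hc₀ : (1 - α) * p * N / 2 ≤ c₀)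
    (hc₁ : (1 - α) * p * N / 2 ≤ c₁) (hm : m₀ + m₁ ≤ 3 / 2 * α * N) :
    m₀ / (c₀ + m₀) + m₁ / (c₁ + m₁) ≤ deltaPar α p := by
  set c := p * N / 4 with hcdef
  have hpN : 0 < p * N := mul_pos hp hN
  have hc : 0 < c := by positivity
  have hcle : c ≤ (1 - α) * p * N / 2 := by nlinarith
  have h0 : m₀ / (c₀ + m₀) ≤ m₀ / (c + m₀) := by gcongr; linarith
  have h1 : m₁ / (c₁ + m₁) ≤ m₁ / (c + m₁) := by gcongr; linarith
  set M := m₀ + m₁ with hM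
  have hM0 : 0 ≤ M := by positivity
  have h2 : m₀ / (c + m₀) + m₁ / (c + m₁) ≤ 2 * M / (2 * c + M) := by
    rw [div_add_div _ _ (by positivity) (by positivity),
      div_le_div_iff₀ (by positivity) (by positivity)]
    nlinarith [mul_nonneg hc.le (sq_nonneg (m₀ - m₁)), mul_nonneg hm₀ hm₁]
  have h3 : 2 * M / (2 * c + M) ≤ deltaPar α p := by
    unfold deltaPar
    rw [div_le_div_iff₀ (by positivity) (by positivity)]
    have : M * (p / 3) ≤ 3 / 2 * α * N * (p / 3) := by gcongr
    nlinarith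
  linarith

/-- Dividing a deviation bound for the positives of a group by one for its size. -/
lemma ratio_deviation {k l p N D : ℝ} (hN : 0 < N) (hp0 : 0 ≤ p) (hp1 : p ≤ 1)
    (hDN : 1024 * D ≤ N) (hk : |k - N * p| ≤ 8 * √(N * D))
    (hl : |l - N * (1 - p)| ≤ 8 * √(N * D)) :
    N / 2 ≤ k + l ∧ |k / (k + l) - p| ≤ 48 * √(D / N) := by
  -- Makes the error `16√(ND)` of `k + l` at most `N/2`.
  have hr : 32 * √(N * D) ≤ N := by
    rw [show (32 : ℝ) = √1024 by
      rw [show (1024 : ℝ) = 32 ^ 2 by norm_num, Real.sqrt_sq (by norm_num)],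
      ← Real.sqrt_mul (by norm_num)]
    exact Real.sqrt_le_iff.2 ⟨hN.le, by nlinarith⟩
  rw [abs_le] at hk hl
  have hkl : N / 2 ≤ k + l := by nlinarith
  have hpos : 0 < k + l := by linarith
  refine ⟨hkl, ?_⟩
  have e1 : k / (k + l) - p = (k - (k + l) * p) / (k + l) := by field_simp
  have e2 : √(N * D) = N * √(D / N) := by
    have : N * D = N ^ 2 * (D / N) := by field_simp
    rw [this, Real.sqrt_mul (by positivity), Real.sqrt_sq hN.le]
  have hsq : 0 ≤ √(D / N) := Real.sqrt_nonneg _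
  rw [e1, abs_div, abs_of_pos hpos, div_le_iff₀ hpos]
  -- `k - (k + l)p = (k - Np) - p((k + l) - N)`, with errors `8 + 16`; dividing by `k + l ≥ N/2`
  -- doubles the 24.
  have h24 : |k - (k + l) * p| ≤ 24 * √(N * D) := by
    rw [abs_le]
    constructor <;> nlinarith [Real.sqrt_nonneg (N * D)]
  rw [e2] at h24
  nlinarith

end Deterministic

/-! ### Ranges of rates and deviations -/

section Bounds

variable {X : Type*} {n : ℕ}

lemma empRisk_mem_Icc (S : Dataset X n) (h : X → Fin 2) : empRisk S h ∈ Set.Icc (0 : ℝ) 1 := by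
  unfold empRisk
  refine ⟨by positivity, div_le_one_of_le₀ ?_ (by positivity)⟩
  simpa using Finset.card_le_univ (Finset.univ.filter fun i => h (S i).1 ≠ (S i).2.2)

lemma empPositiveRate_mem_Icc (S : Dataset X n) (h : X → Fin 2) (a : Fin 2) :
    empPositiveRate S h a ∈ Set.Icc (0 : ℝ) 1 := by
  unfold empPositiveRate
  refine ⟨by positivity, div_le_one_of_le₀ ?_ (by positivity)⟩
  exact_mod_cast Finset.card_le_card fun i hi => by
    simp only [Finset.mem_filter, Finset.mem_univ, true_and] at hi ⊢
    exact hi.2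

lemma empParityDeviation_mem_Icc (S : Dataset X n) (h : X → Fin 2) :
    empParityDeviation S h ∈ Set.Icc (0 : ℝ) 1 := by
  obtain ⟨h1, h2⟩ := empPositiveRate_mem_Icc S h 0
  obtain ⟨h3, h4⟩ := empPositiveRate_mem_Icc S h 1
  exact ⟨abs_nonneg _, abs_le.2 ⟨by linarith, by linarith⟩⟩

variable [MeasurableSpace X] {P : Measure (DataPoint X)} [IsProbabilityMeasure P]

lemma measurableSet_group (a : Fin 2) : MeasurableSet {z : DataPoint X | z.2.1 = a} :=
  (measurable_fst.comp measurable_snd) (measurableSet_singleton a)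

lemma positiveRate_eq (P : Measure (DataPoint X)) (h : X → Fin 2) (a : Fin 2) :
    positiveRate P h a = (groupProb P a)⁻¹ * P.real {z | z.2.1 = a ∧ h z.1 = 1} := by
  unfold positiveRate groupProb
  rw [measureReal_def, cond_apply (measurableSet_group a), ENNReal.toReal_mul, ENNReal.toReal_inv]
  rfl

lemma positiveRate_mem_Icc (h : X → Fin 2) (a : Fin 2) :
    positiveRate P h a ∈ Set.Icc (0 : ℝ) 1 := by
  rw [positiveRate_eq]
  refine ⟨mul_nonneg (inv_nonneg.2 measureReal_nonneg) measureReal_nonneg, ?_⟩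
  rw [inv_mul_eq_div]
  exact div_le_one_of_le₀ (measureReal_mono fun z hz => hz.1) measureReal_nonneg

lemma parityDeviation_mem_Icc (h : X → Fin 2) : parityDeviation P h ∈ Set.Icc (0 : ℝ) 1 := by
  obtain ⟨h1, h2⟩ := positiveRate_mem_Icc (P := P) h 0
  obtain ⟨h3, h4⟩ := positiveRate_mem_Icc (P := P) h 1
  exact ⟨abs_nonneg _, abs_le.2 ⟨by linarith, by linarith⟩⟩

lemma groupProb_zero_add_one (P : Measure (DataPoint X)) [IsProbabilityMeasure P] :
    groupProb P 0 + groupProb P 1 = 1 := by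
  unfold groupProb
  have : {z : DataPoint X | z.2.1 = 1} = {z | z.2.1 = 0}ᶜ := by
    ext z
    simp only [Set.mem_ofPred_eq, Set.mem_compl_iff]
    omega
  rw [this, probReal_compl_eq_one_sub (measurableSet_group 0)]
  ring

end Bounds

/-! ### Uniform convergence over `H` -/

section UniformConvergence

variable {X Ω : Type*} [MeasurableSpace X] [MeasurableSpace Ω] {n d : ℕ}
  {H : Set (X → Fin 2)} {P : Measure (DataPoint X)} [IsProbabilityMeasure P] {α δ : ℝ}
  {μ : Measure Ω} {clean : Ω → Dataset X n} {marked : Ω → Fin n → Bool}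
  {corrupted : Ω → Dataset X n}

lemma MaliciousSampling.measure_deviation_le
    (hS : MaliciousSampling P α μ clean marked corrupted) (hd : vcDim H ≤ d) (hd1 : 1 ≤ d)
    (hH : MeasurableClass H (P.map Prod.fst)) (hn : 1 ≤ n) (hδ0 : 0 < δ) (hδ1 : δ < 1)
    {β : Measure Bool} [IsProbabilityMeasure β]
    (hlaw : μ.map (fun ω i => (clean ω i, marked ω i)) = Measure.pi fun _ : Fin n => P.prod β)
    {W : Set (DataPoint X × Bool)} (hW : MeasurableSet W) {y : DataPoint X × Bool → Fin 2}
    (hy : Measurable y) (hlarge : d * Real.log (2 * n / δ) ≤ n * (P.prod β).real W) :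
    μ {ω | ∃ h ∈ H, 8 * √(n * (P.prod β).real W * (d * Real.log (2 * n / δ))) ≤
        |∑ i, maskedLoss W y (h (clean ω i).1) (clean ω i, marked ω i) -
          n * ∫ u, maskedLoss W y (h u.1.1) u ∂(P.prod β)|} ≤ ENNReal.ofReal (δ / 8) := by
  have hx : Measurable fun u : DataPoint X × Bool => u.1.1 := by fun_prop
  have hmap : (P.prod β).map (fun u : DataPoint X × Bool => u.1.1) = P.map Prod.fst := by
    have : (fun u : DataPoint X × Bool => u.1.1) = Prod.fst ∘ Prod.fst := rfl
    rw [this, ← Measure.map_map measurable_fst measurable_fst, Measure.map_fst_prod,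
      measure_univ, one_smul]
  have h := measure_exists_deviation_le_confidence (ν := P.prod β) hd hd1 hx (by rwa [hmap]) hW hy
    hn hδ0 hδ1 hlarge
  rw [← hlaw] at h
  -- This inequality holds for arbitrary sets, so the event need not be measurable.
  exact (Measure.le_map_apply hS.measurable_pair.aemeasurable _).trans h

lemma sqrt_mul_div_eq {D L N : ℝ} (hL : 0 ≤ L) : √L * √(D / N) = √(D * L / N) := by
  rw [← Real.sqrt_mul hL]
  congr 1
  ring

/-- Uniform convergence of the clean empirical risk. -/
lemma MaliciousSampling.exists_risk_deviation [IsProbabilityMeasure μ]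
    (hS : MaliciousSampling P α μ clean marked corrupted) (hd : vcDim H ≤ d) (hd1 : 1 ≤ d)
    (hH : MeasurableClass H (P.map Prod.fst)) (hn : 1 ≤ n) (hδ0 : 0 < δ) (hδ1 : δ < 1) :
    ∃ B : Set Ω, μ B ≤ ENNReal.ofReal (δ / 8) ∧ ∀ ω ∉ B, ∀ h ∈ H,
      |empRisk (clean ω) h - risk P h| ≤ 8 * (√(Real.log (2 * n / δ)) * √((d : ℝ) / n)) := by
  have hL := log_two_mul_div_pos hn hδ0 hδ1
  have hn0 : (0 : ℝ) < n := by exact_mod_cast hn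
  rw [sqrt_mul_div_eq hL.le]
  by_cases hlarge : d * Real.log (2 * n / δ) ≤ n
  · obtain ⟨β, hβ, -, hlaw⟩ := hS.exists_map_eq_pi hn
    have hy : Measurable fun u : DataPoint X × Bool => u.1.2.2 := by fun_prop
    refine ⟨_, hS.measure_deviation_le hd hd1 hH hn hδ0 hδ1 hlaw MeasurableSet.univ hy
      (by simpa using hlarge), fun ω hω h hh => ?_⟩
    have hω' := not_le.1 fun hle => hω ⟨h, hh, hle⟩
    have hhm : Measurable fun u : DataPoint X × Bool => h u.1.1 :=
      (hH.measurable h hh).comp (by fun_prop)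
    rw [sum_maskedLoss, integral_maskedLoss MeasurableSet.univ hy hhm] at hω'
    have hrisk : (P.prod β).real {u | u ∈ Set.univ ∧ h u.1.1 ≠ u.1.2.2} = risk P h := by
      have : {u : DataPoint X × Bool | u ∈ Set.univ ∧ h u.1.1 ≠ u.1.2.2} =
          {z : DataPoint X | h z.1 ≠ z.2.2} ×ˢ Set.univ := by
        ext u; simp
      rw [this, measureReal_prod_prod, probReal_univ, mul_one]
      rfl
    rw [hrisk] at hω'
    have hcard : ((Finset.univ.filter fun i => (clean ω i, marked ω i) ∈ (Set.univ : Set _) ∧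
        h (clean ω i).1 ≠ (clean ω i).2.2).card : ℝ) = n * empRisk (clean ω) h := by
      unfold empRisk
      rw [mul_div_cancel₀ _ hn0.ne']
      simp
    simp only [hcard] at hω'
    rw [← mul_sub, abs_mul, Nat.abs_cast, probReal_univ, mul_one] at hω'
    set D := d * Real.log (2 * n / δ)
    have e2 : √(n * D) = n * √(D / n) := by
      have : n * D = (n : ℝ) ^ 2 * (D / n) := by field_simp
      rw [this, Real.sqrt_mul (by positivity), Real.sqrt_sq hn0.le]
    rw [e2] at hω'
    have : (n : ℝ) * |empRisk (clean ω) h - risk P h| ≤ n * (8 * √(D / n)) := by linarith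
    exact le_of_mul_le_mul_left this hn0
  -- Here the right side is at least 8, while both risks lie in `[0, 1]`.
  · refine ⟨∅, by simp, fun ω _ h _ => ?_⟩
    have h1 : 1 ≤ √(d * Real.log (2 * n / δ) / n) := by
      rw [Real.one_le_sqrt, one_le_div hn0]
      exact (not_le.1 hlarge).le
    obtain ⟨e0, e1⟩ := empRisk_mem_Icc (clean ω) h
    have r0 : 0 ≤ risk P h := measureReal_nonneg
    have r1 : risk P h ≤ 1 := measureReal_le_one
    rw [abs_le]
    constructor <;> linarith

/-- Uniform convergence of the positive rates among the unmarked points of a group. -/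
lemma MaliciousSampling.exists_positiveRate_deviation [IsProbabilityMeasure μ]
    (hS : MaliciousSampling P α μ clean marked corrupted) (hd : vcDim H ≤ d) (hd1 : 1 ≤ d)
    (hH : MeasurableClass H (P.map Prod.fst)) (hn : 1 ≤ n) (hδ0 : 0 < δ) (hδ1 : δ < 1)
    (hα' : α < 1 / 2) {P₀ : ℝ} (hP₀ : 0 < P₀) (a : Fin 2)
    (ha : P₀ ≤ groupProb P a) (hlarge : 2048 * (d * Real.log (2 * n / δ)) ≤ P₀ * n) :
    ∃ B : Set Ω, μ B ≤ ENNReal.ofReal (δ / 8) + ENNReal.ofReal (δ / 8) ∧ ∀ ω ∉ B, ∀ h ∈ H,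
      (1 - α) * P₀ * n / 2 ≤ unmarkedCount (clean ω) (marked ω) a ∧
      |(unmarkedPositives (clean ω) (marked ω) h a : ℝ) / unmarkedCount (clean ω) (marked ω) a -
        positiveRate P h a| ≤ 68 * (√(Real.log (2 * n / δ)) * √((d : ℝ) / (P₀ * n))) := by
  have hL := log_two_mul_div_pos hn hδ0 hδ1
  have hn0 : (0 : ℝ) < n := by exact_mod_cast hn
  have hd0 : (0 : ℝ) < d := by exact_mod_cast hd1
  have hg0 : 0 < groupProb P a := hP₀.trans_le ha
  rw [sqrt_mul_div_eq hL.le]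
  obtain ⟨β, hβ, hβf, hlaw⟩ := hS.exists_map_eq_pi hn
  set D := d * Real.log (2 * n / δ) with hD
  have hD0 : 0 < D := by positivity
  set W : Set (DataPoint X × Bool) := {u | u.1.2.1 = a ∧ u.2 = false} with hWdef
  have hW : MeasurableSet W := by
    have : W = {z : DataPoint X | z.2.1 = a} ×ˢ {false} := by ext u; simp [hWdef]
    rw [this]
    exact (measurableSet_group a).prod (measurableSet_singleton _)
  have hprod : ∀ A : Set (DataPoint X),
      (P.prod β).real {u | u.1 ∈ A ∧ u.2 = false} = (1 - α) * P.real A := by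
    intro A
    have : {u : DataPoint X × Bool | u.1 ∈ A ∧ u.2 = false} = A ×ˢ {false} := by ext u; simp
    rw [this, measureReal_prod_prod, hβf, mul_comm]
  have hWreal : (P.prod β).real W = (1 - α) * groupProb P a := hprod {z | z.2.1 = a}
  set N := n * (P.prod β).real W with hN
  have hNge : (1 - α) * P₀ * n ≤ N := by
    have : (1 - α) * P₀ ≤ (1 - α) * groupProb P a := by gcongr; linarith
    rw [hN, hWreal]; nlinarith
  have hhalf : P₀ * n / 2 ≤ (1 - α) * P₀ * n := by nlinarith [mul_pos hP₀ hn0]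
  have hN0 : 0 < N := by nlinarith [mul_pos hP₀ hn0]
  have hDN : 1024 * D ≤ N := by linarith
  -- Loss against the constant label 0 counts positives, against 1 negatives. Their sum is the size
  -- of the unmarked group, so the denominator needs no separate concentration bound.
  have hB₀ := hS.measure_deviation_le hd hd1 hH hn hδ0 hδ1 hlaw hW
    (measurable_const (a := (0 : Fin 2))) (by linarith)
  have hB₁ := hS.measure_deviation_le hd hd1 hH hn hδ0 hδ1 hlaw hW
    (measurable_const (a := (1 : Fin 2))) (by linarith)
  refine ⟨_, (measure_union_le _ _).trans (add_le_add hB₀ hB₁), fun ω hω h hh => ?_⟩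
  have hω₀ := (not_le.1 fun hle => hω (Or.inl ⟨h, hh, hle⟩)).le
  have hω₁ := (not_le.1 fun hle => hω (Or.inr ⟨h, hh, hle⟩)).le
  have hhm : Measurable fun u : DataPoint X × Bool => h u.1.1 :=
    (hH.measurable h hh).comp (by fun_prop)
  rw [integral_maskedLoss hW measurable_const hhm] at hω₀ hω₁
  have hone : ∀ c : Fin 2, c ≠ 0 ↔ c = 1 := by decide
  have hset : ∀ b : Fin 2, {u : DataPoint X × Bool | u ∈ W ∧ h u.1.1 ≠ b} =
      {u | u.1 ∈ {z : DataPoint X | z.2.1 = a ∧ h z.1 ≠ b} ∧ u.2 = false} := by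
    intro b
    ext u
    simp only [hWdef, Set.mem_ofPred_eq]
    tauto
  have hmul : groupProb P a * positiveRate P h a = P.real {z | z.2.1 = a ∧ h z.1 = 1} := by
    rw [positiveRate_eq, mul_inv_cancel_left₀ hg0.ne']
  have hcompl : P.real {z | z.2.1 = a ∧ h z.1 ≠ 1} =
      groupProb P a * (1 - positiveRate P h a) := by
    have hm1 : MeasurableSet {z : DataPoint X | h z.1 = 1} :=
      ((hH.measurable h hh).comp measurable_fst) (measurableSet_singleton 1)
    have := measureReal_inter_add_sdiff (μ := P) (s := {z : DataPoint X | z.2.1 = a}) hm1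
    rw [mul_sub, mul_one, hmul, eq_sub_iff_add_eq, add_comm]
    exact this
  rw [hset, hprod] at hω₀ hω₁
  simp only [hone] at hω₀
  rw [← hmul] at hω₀
  rw [hcompl] at hω₁
  have hk : ∑ i, maskedLoss W (fun _ => 0) (h (clean ω i).1) (clean ω i, marked ω i) =
      unmarkedPositives (clean ω) (marked ω) h a := by
    rw [sum_maskedLoss]
    unfold unmarkedPositives
    congr 2
    ext i
    simp only [hone, hWdef, Set.mem_ofPred_eq, Finset.mem_filter]
  have hsum : (unmarkedPositives (clean ω) (marked ω) h a : ℝ) +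
      ∑ i, maskedLoss W (fun _ => 1) (h (clean ω i).1) (clean ω i, marked ω i) =
        unmarkedCount (clean ω) (marked ω) a := by
    unfold unmarkedCount
    rw [← hk, ← Finset.sum_add_distrib, Finset.card_filter]
    push_cast
    refine Finset.sum_congr rfl fun i _ => ?_
    have hval : h (clean ω i).1 = 0 ∨ h (clean ω i).1 = 1 := by omega
    by_cases hi : (clean ω i).2.1 = a ∧ marked ω i = false <;>
      rcases hval with hv | hv <;> simp [maskedLoss, hWdef, hi, hv]
  obtain ⟨p0, p1⟩ := positiveRate_mem_Icc (P := P) h a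
  rw [hk] at hω₀
  have hassoc : ∀ r : ℝ, n * ((1 - α) * (groupProb P a * r)) = N * r := by
    intro r
    rw [hN, hWreal]
    ring
  rw [hassoc] at hω₀ hω₁
  obtain ⟨r1, r2⟩ := ratio_deviation hN0 p0 p1 hDN hω₀ hω₁
  rw [hsum] at r1 r2
  refine ⟨by linarith, r2.trans ?_⟩
  -- `N ≥ P₀n/2` costs a factor `√2 ≤ 17/12`, and `48 · 17/12 = 68`.
  have h2 : √(D / N) ≤ √2 * √(D / (P₀ * n)) := by
    rw [← Real.sqrt_mul (by norm_num)]
    refine Real.sqrt_le_sqrt ?_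
    rw [mul_div_assoc', div_le_div_iff₀ hN0 (mul_pos hP₀ hn0)]
    nlinarith
  have h3 : √2 ≤ 17 / 12 := Real.sqrt_le_iff.2 ⟨by norm_num, by norm_num⟩
  have h4 : 0 ≤ √(D / (P₀ * n)) := Real.sqrt_nonneg _
  nlinarith

/-- Uniform convergence of the parity deviation of the corrupted sample. -/
lemma MaliciousSampling.exists_parity_deviation [IsProbabilityMeasure μ]
    (hS : MaliciousSampling P α μ clean marked corrupted) (hd : vcDim H ≤ d) (hd1 : 1 ≤ d)
    (hH : MeasurableClass H (P.map Prod.fst)) (hn : 1 ≤ n) (hδ0 : 0 < δ) (hδ1 : δ < 1)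
    (hα : 0 ≤ α) (hα' : α < 1 / 2) {P₀ : ℝ} (hP₀ : 0 < P₀)
    (ha : ∀ a, P₀ ≤ groupProb P a) :
    ∃ B : Set Ω, μ B ≤ ENNReal.ofReal (δ / 2) ∧ ∀ ω ∉ B,
      (∀ i, marked ω i = false → corrupted ω i = clean ω i) →
      ((Finset.univ.filter fun i => marked ω i = true).card : ℝ) ≤ 3 / 2 * α * n →
      ∀ h ∈ H, |empParityDeviation (corrupted ω) h - parityDeviation P h| ≤
        deltaPar α P₀ + 136 * (√(Real.log (2 * n / δ)) * √((d : ℝ) / (P₀ * n))) := by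
  have hL := log_two_mul_div_pos hn hδ0 hδ1
  have hn0 : (0 : ℝ) < n := by exact_mod_cast hn
  have hPn : 0 < P₀ * n := mul_pos hP₀ hn0
  by_cases hlarge : 2048 * (d * Real.log (2 * n / δ)) ≤ P₀ * n
  · obtain ⟨B₀, hB₀, h₀⟩ := hS.exists_positiveRate_deviation hd hd1 hH hn hδ0 hδ1 hα' hP₀ 0
      (ha 0) hlarge
    obtain ⟨B₁, hB₁, h₁⟩ := hS.exists_positiveRate_deviation hd hd1 hH hn hδ0 hδ1 hα' hP₀ 1
      (ha 1) hlarge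
    refine ⟨B₀ ∪ B₁, ?_, fun ω hω hagree hM h hh => ?_⟩
    · refine (measure_union_le _ _).trans ((add_le_add hB₀ hB₁).trans_eq ?_)
      have h8 : 0 ≤ δ / 8 := by positivity
      rw [← ENNReal.ofReal_add h8 h8, ← ENNReal.ofReal_add (by positivity) (by positivity)]
      congr 1
      ring
    · obtain ⟨c0, r0⟩ := h₀ ω (fun hb => hω (Or.inl hb)) h hh
      obtain ⟨c1, r1⟩ := h₁ ω (fun hb => hω (Or.inr hb)) h hh
      have hcpos : 0 < (1 - α) * P₀ * n / 2 := by nlinarith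
      have q0 := abs_empPositiveRate_sub_le hagree h 0 (by exact_mod_cast hcpos.trans_le c0)
      have q1 := abs_empPositiveRate_sub_le hagree h 1 (by exact_mod_cast hcpos.trans_le c1)
      have hsum := markedCount_zero_add_one (corrupted ω) (marked ω)
      rw [← hsum] at hM
      push_cast at hM
      have hΔ := div_add_div_le_deltaPar hP₀ hn0 hα hα'
        (Nat.cast_nonneg (markedCount (corrupted ω) (marked ω) 0))
        (Nat.cast_nonneg (markedCount (corrupted ω) (marked ω) 1)) c0 c1 hM
      unfold empParityDeviation parityDeviation
      refine (abs_abs_sub_abs_le _ _).trans ?_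
      rw [abs_le] at r0 r1 q0 q1 ⊢
      constructor <;> linarith
  -- Here `√(D / (P₀ n)) ≥ 1/46`, as `46² ≥ 2048`, so the right side exceeds 1 and the bound is
  -- trivial.
  · refine ⟨∅, by simp, fun ω _ _ _ h _ => ?_⟩
    rw [sqrt_mul_div_eq hL.le]
    have h1 : 1 / 46 ≤ √(d * Real.log (2 * n / δ) / (P₀ * n)) := by
      refine Real.le_sqrt_of_sq_le ?_
      rw [le_div_iff₀ hPn]
      linarith [not_le.1 hlarge]
    obtain ⟨e0, e1⟩ := empParityDeviation_mem_Icc (corrupted ω) h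
    obtain ⟨r0, r1⟩ := parityDeviation_mem_Icc (P := P) h
    have hΔ : 0 ≤ deltaPar α P₀ := by unfold deltaPar; positivity
    rw [abs_le]
    constructor <;> linarith

end UniformConvergence

/-! ### From uniform convergence to the theorem -/

/-- A point where two hypotheses differ is shattered. -/
lemma eq_of_vcDim_eq_zero {X : Type*} {H : Set (X → Fin 2)} (hd : vcDim H = 0) {h h' : X → Fin 2}
    (hh : h ∈ H) (hh' : h' ∈ H) : h = h' := by
  by_contra hne
  obtain ⟨z, hz⟩ := Function.ne_iff.1 hne
  have hs : Shatters H {z} := by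
    intro t _
    have hex : ∀ b : Fin 2, ∃ g ∈ H, g z = b := by
      intro b
      by_cases hb : h z = b
      · exact ⟨h, hh, hb⟩
      · exact ⟨h', hh', by omega⟩
    by_cases hzt : z ∈ t
    · obtain ⟨g, hg, hgz⟩ := hex 1
      exact ⟨g, hg, by simp [hgz, hzt]⟩
    · obtain ⟨g, hg, hgz⟩ := hex 0
      exact ⟨g, hg, by simp [hgz, hzt]⟩
  have := Shatters.card_le (d := 0) (by simp [hd]) hs
  simp at this

/-- Comparison of an empirical minimiser with the infimum of the population objective. -/
lemma weightedObjective_le_iInf_add {X : Type*} [MeasurableSpace X] {n : ℕ} {H : Set (X → Fin 2)}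
    {P : Measure (DataPoint X)} {lam : ℝ} (hlam : 0 ≤ lam) {S : Dataset X n} {g : X → Fin 2}
    (hg : g ∈ H) (hmin : ∀ h ∈ H, empObjective S lam g ≤ empObjective S lam h) {ε η : ℝ}
    (hrisk : ∀ h ∈ H, |empRisk S h - risk P h| ≤ ε)
    (hpar : ∀ h ∈ H, |empParityDeviation S h - parityDeviation P h| ≤ η) :
    weightedObjective P lam g ≤ (⨅ h : H, weightedObjective P lam h) + 2 * (ε + lam * η) := by
  have : Nonempty H := ⟨⟨g, hg⟩⟩
  rw [← sub_le_iff_le_add]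
  refine le_ciInf fun ⟨h, hh⟩ => ?_
  have key : ∀ f ∈ H, |empObjective S lam f - weightedObjective P lam f| ≤ ε + lam * η := by
    intro f hf
    unfold empObjective weightedObjective
    rw [show empRisk S f + lam * empParityDeviation S f - (risk P f + lam * parityDeviation P f) =
      (empRisk S f - risk P f) + lam * (empParityDeviation S f - parityDeviation P f) by ring]
    refine (abs_add_le _ _).trans (add_le_add (hrisk f hf) ?_)
    rw [abs_mul, abs_of_nonneg hlam]
    exact mul_le_mul_of_nonneg_left (hpar f hf) hlam
  have h1 := abs_le.1 (key g hg)
  have h2 := abs_le.1 (key h hh)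
  have h3 := hmin h hh
  dsimp only
  linarith

/-- The bad events are controlled only in outer measure; the complement of a measurable hull serves
as the good event. -/
lemma exists_measurableSet_of_measure_lt {Ω : Type*} [MeasurableSpace Ω] {μ : Measure Ω}
    [IsProbabilityMeasure μ] {B : Set Ω} {δ : ℝ} (hδ : 0 < δ) (hB : μ B < ENNReal.ofReal δ) :
    ∃ E : Set Ω, MeasurableSet E ∧ 1 - δ < μ.real E ∧ ∀ ω ∈ E, ω ∉ B := by
  refine ⟨(toMeasurable μ B)ᶜ, (measurableSet_toMeasurable μ B).compl, ?_,
    fun ω hω hb => hω (subset_toMeasurable μ B hb)⟩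
  rw [probReal_compl_eq_one_sub (measurableSet_toMeasurable μ B), measureReal_def,
    measure_toMeasurable]
  have := (ENNReal.toReal_lt_toReal hB.ne_top ENNReal.ofReal_ne_top).2 hB
  rw [ENNReal.toReal_ofReal hδ.le] at this
  linarith

end FairLearning

theorem theorem5 :
    ∃ C K : ℝ, 0 < C ∧ 0 < K ∧
      ∀ (X : Type*) [MeasurableSpace X]
        (H : Set (X → Fin 2)) (d : ℕ) (_ : FairLearning.vcDim H = (d : ℕ∞))
        (lam : ℝ) (_ : 0 ≤ lam)
        (learner : (n : ℕ) → FairLearning.Dataset X n → (X → Fin 2))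
        (_ : FairLearning.MinimizesEmpObjective H lam learner)
        (P : Measure (FairLearning.DataPoint X)) [IsProbabilityMeasure P]
        (_ : FairLearning.MeasurableClass H (P.map Prod.fst))
        (P₀ : ℝ) (_ : P₀ = FairLearning.groupProb P 0) (_ : 0 < P₀) (_ : P₀ ≤ 1 / 2)
        (α : ℝ) (_ : 0 ≤ α) (_ : α < 1 / 2),
        FairLearning.deltaPar α P₀ ≤ K * (α / P₀) ∧
        ∀ (δ : ℝ) (_ : 0 < δ) (_ : δ < 1) (n : ℕ)
          (_ : 8 * Real.log (16 / δ) / ((1 - α) * P₀) ≤ n)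
          (_ : 12 * Real.log (12 / δ) / α ≤ n)
          (_ : (d : ℝ) / 2 ≤ n)
          (Ω : Type*) [MeasurableSpace Ω] (μ : Measure Ω) [IsProbabilityMeasure μ]
          (clean : Ω → FairLearning.Dataset X n) (marked : Ω → Fin n → Bool)
          (corrupted : Ω → FairLearning.Dataset X n)
          (_ : FairLearning.MaliciousSampling P α μ clean marked corrupted),
          ∃ E : Set Ω, MeasurableSet E ∧ 1 - δ < μ.real E ∧
            ∀ ω ∈ E,
              FairLearning.weightedObjective P lam (learner n (corrupted ω)) ≤
                (⨅ h : H, FairLearning.weightedObjective P lam h) +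
                  (3 * α + lam * (2 * FairLearning.deltaPar α P₀) +
                    C * √(Real.log (2 * n / δ)) *
                      (√((d : ℝ) / n) + lam * √((d : ℝ) / (P₀ * n)))) := by
  -- `300` dominates `2 · 8` for the risk and `2 · 136` for the parity term; `6` comes from `P₀/3 +
  -- α ≥ P₀/3`.
  refine ⟨300, 6, by norm_num, by norm_num, ?_⟩
  intro X _ H d hd lam hlam learner hlearn P _ hH P₀ hP₀ hP₀pos hP₀le α hα hα'
  refine ⟨?_, ?_⟩
  · unfold FairLearning.deltaPar
    rw [mul_div_assoc', div_le_div_iff₀ (by positivity) hP₀pos]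
    nlinarith [mul_nonneg hα hα]
  intro δ hδ0 hδ1 n hn₁ hn₂ _ Ω _ μ _ clean marked corrupted hS
  have hn : 1 ≤ n := by
    have hlog : 0 < Real.log (16 / δ) := Real.log_pos (by rw [lt_div_iff₀ hδ0]; linarith)
    have hden : 0 < (1 - α) * P₀ := mul_pos (by linarith) hP₀pos
    have : (0 : ℝ) < n := lt_of_lt_of_le (by positivity) hn₁
    exact_mod_cast this
  have hn0 : (0 : ℝ) < n := by exact_mod_cast hn
  have hΔ : 0 ≤ FairLearning.deltaPar α P₀ := by unfold FairLearning.deltaPar; positivity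
  -- For `d = 0` the sampling error term vanishes, leaving no room for concentration; but then `H`
  -- has a single element.
  rcases Nat.eq_zero_or_pos d with rfl | hd1
  · refine ⟨Set.univ, MeasurableSet.univ, by simpa using hδ0, fun ω _ => ?_⟩
    have hg := (hlearn n hn (corrupted ω)).1
    have : Nonempty H := ⟨⟨_, hg⟩⟩
    have hinf : FairLearning.weightedObjective P lam (learner n (corrupted ω)) ≤
        ⨅ h : H, FairLearning.weightedObjective P lam h :=
      le_ciInf fun h => by
        rw [FairLearning.eq_of_vcDim_eq_zero (by simpa using hd) h.2 hg]
    refine hinf.trans (le_add_of_nonneg_right ?_)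
    positivity
  have hP₁ : ∀ a, P₀ ≤ FairLearning.groupProb P a := by
    have hadd := FairLearning.groupProb_zero_add_one P
    intro a
    fin_cases a
    · exact hP₀.le
    · show P₀ ≤ FairLearning.groupProb P 1
      linarith
  obtain ⟨B₁, hB₁, hrisk⟩ := hS.exists_risk_deviation hd.le hd1 hH hn hδ0 hδ1
  obtain ⟨B₂, hB₂, hpar⟩ := hS.exists_parity_deviation hd.le hd1 hH hn hδ0 hδ1 hα hα' hP₀pos hP₁
  have hB₃ := hS.measure_marks_gt_le hα hδ0 hn₂
  set B₃ := {ω | 3 / 2 * α * n < ((Finset.univ.filter fun i => marked ω i = true).card : ℝ)}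
    with hB₃def
  set B₄ := {ω | ¬ ∀ i, marked ω i = false → corrupted ω i = clean ω i} with hB₄def
  have hB₄ : μ B₄ = 0 := ae_iff.1 hS.unmarked_eq
  have hB : μ (B₁ ∪ B₂ ∪ B₃ ∪ B₄) < ENNReal.ofReal δ := by
    calc μ (B₁ ∪ B₂ ∪ B₃ ∪ B₄) ≤ μ B₁ + μ B₂ + μ B₃ + μ B₄ := by
          refine (measure_union_le _ _).trans ?_
          gcongr
          refine (measure_union_le _ _).trans ?_
          gcongr
          exact measure_union_le _ _
      _ ≤ ENNReal.ofReal (δ / 8) + ENNReal.ofReal (δ / 2) + ENNReal.ofReal (δ / 12) + 0 := by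
          gcongr
          exact hB₄.le
      _ = ENNReal.ofReal (δ / 8 + δ / 2 + δ / 12) := by
          rw [add_zero, ← ENNReal.ofReal_add (by positivity) (by positivity),
            ← ENNReal.ofReal_add (by positivity) (by positivity)]
      _ < ENNReal.ofReal δ := (ENNReal.ofReal_lt_ofReal_iff hδ0).2 (by linarith)
  obtain ⟨E, hE, hμE, hEB⟩ := FairLearning.exists_measurableSet_of_measure_lt hδ0 hB
  refine ⟨E, hE, hμE, fun ω hω => ?_⟩
  have hω' := hEB ω hω
  simp only [Set.mem_union, not_or] at hω'
  obtain ⟨⟨⟨h₁, h₂⟩, h₃⟩, h₄⟩ := hω'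
  have hagree : ∀ i, marked ω i = false → corrupted ω i = clean ω i := not_not.1 h₄
  have hM : ((Finset.univ.filter fun i => marked ω i = true).card : ℝ) ≤ 3 / 2 * α * n :=
    not_lt.1 h₃
  obtain ⟨hg, hmin⟩ := hlearn n hn (corrupted ω)
  set R := √(Real.log (2 * n / δ)) * √((d : ℝ) / n) with hR
  set T := √(Real.log (2 * n / δ)) * √((d : ℝ) / (P₀ * n)) with hT
  have hcorr : ∀ h ∈ H, |FairLearning.empRisk (corrupted ω) h - FairLearning.risk P h| ≤
      3 / 2 * α + 8 * R := by
    intro h hh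
    have e1 := FairLearning.abs_empRisk_sub_le hagree h
    have e2 := hrisk ω h₁ h hh
    have e3 : ((Finset.univ.filter fun i => marked ω i = true).card : ℝ) / n ≤ 3 / 2 * α := by
      rwa [div_le_iff₀ hn0]
    exact (abs_sub_le _ _ _).trans (add_le_add (e1.trans e3) e2)
  refine (FairLearning.weightedObjective_le_iInf_add hlam hg hmin hcorr
    (hpar ω h₂ hagree hM)).trans ?_
  have hR0 : 0 ≤ R := by positivity
  have hT0 : 0 ≤ lam * T := by positivity
  have hsplit : 300 * √(Real.log (2 * n / δ)) *
      (√((d : ℝ) / n) + lam * √((d : ℝ) / (P₀ * n))) = 300 * R + 300 * (lam * T) := by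
    rw [hR, hT]
    ring
  rw [hsplit]
  linarith
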